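/- Let $d\ge 0$, let $\Lambda\subset\mathbb{R}^d$ be a lattice (a discrete subgroup spanning $\mathbb{R}^d$), and let $\xi:\mathbb{R}^d\to\mathbb{R}$ be continuous with $e^{-\xi}$ integrable. Assume that for every $k\in\Lambda$ $$e^{-\epsilon(k)}:=\int_{\mathbb{R}^d}e^{-\xi(x)}e^{-2\pi i\langle k,x\rangle}\,dx$$ is real and $\ge 0$ (the value $0$, i.e. $\epsilon(k)=\infty$, being allowed), and that $\sum_{k\in\Lambda}e^{-\epsilon(k)}<\infty$. Let $(\alpha_m)_{m\ge1}$ be a sequence of real numbers. For $\sigma\in S_n$ let $C_m(\sigma)$ be the number of cycles of length $m$ (fixed points being cycles of length $1$) and $K_{0n}(\sigma)=\sum_{m=1}^nC_m(\sigma)$ the total number of cycles. The spatial measure on $S_n$ is $$\mathbb{P}_n[\sigma]=\frac{1}{n!\,h_n}\prod_{m=1}^nF_m\bigl(C_m(\sigma)\bigr),\qquad F_m(c)=\Bigl(e^{-\alpha_m}\sum_{k\in\Lambda}e^{-\epsilon(k)m}\Bigr)^c,$$ with $h_n$ the normalization constant. Put $$g^{(\alpha)}(t)=\sum_{m\ge1}\frac{e^{-\alpha_m}}{m}t^m,\quad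 g^{(\alpha,\xi)}(t)=\sum_{k\in\Lambda}g^{(\alpha)}(e^{-\epsilon(k)}t),\quad \widetilde r=\min_{k\in\Lambda}e^{\epsilon(k)},\quad A=\#\{k\in\Lambda: e^{\epsilon(k)}=\widetilde r\}.$$ For $\rho>0$ and $\theta\ge0$, a power series $g$ is said to be of class $\mathcal{F}(\rho,\theta)$ with constant $K\in\mathbb{C}$ if, for some $R>\rho$ and $0<\phi<\pi/2$, it extends to a holomorphic function on $\Delta_0(\rho,R,\phi)=\{z:|z|<R,\ z\ne\rho,\ |\arg(z-\rho)|>\phi\}$ with $$g(t)=\theta\log\frac{1}{1-t/\rho}+K+O(t-\rho)\qquad\text{as }t\to\rho\text{ in }\Delta_0(\rho,R,\phi).$$ Random variables $Z_n$ on probability spaces converge in the strong mod-Poisson sense with parameters $\lambda_n\in\mathbb{R}$ and limiting function $\Psi$ if $\Psi:\mathbb{R}\to\mathbb{C}$ is continuous, $\Psi(0)=1$, and $\exp\bigl(\lambda_n(1-e^{is})\bigr)\,\mathbb{E}[e^{isZ_n}]\to\Psi(s)$ locally uniformly in $s\in\mathbb{R}$. **Theorem.** Let $\alpha>0$ and $r>0$,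 and let $g^{(\alpha)}$ be of class $\mathcal{F}(r,\alpha)$ (with some constant). Then $g^{(\alpha,\xi)}$ is of class $\mathcal{F}(\widetilde r r,A\alpha)$ with a real constant $K$. Under the spatial measures $\mathbb{P}_n$, the total number of cycles $K_{0n}$ converges in the strong mod-Poisson sense with parameters $K+A\alpha\log n$ and limiting function $$\frac{\Gamma(\alpha)}{\Gamma(\alpha e^{is})}$$ (where $1/\Gamma$ is $0$ at the poles of $\Gamma$). Equivalently, it converges in the strong mod-Poisson sense with parameters $A\alpha\log n$ and limiting function $e^{K(e^{is}-1)}\,\Gamma(\alpha)/\Gamma(\alpha e^{is})$. -/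

import Mathlib

open Filter Topology MeasureTheory Asymptotics

noncomputable section

namespace SpatialPerm

/-! ### Permutations and generalized weighted measures -/

/-- `C_m(σ)`: the number of cycles of length `m` of `σ ∈ S_n` (fixed points are the cycles of
length `1`). -/
def cycleCount {n : ℕ} (m : ℕ) (σ : Equiv.Perm (Fin n)) : ℕ :=
  σ.partition.parts.count m

/-- `K_{0n}(σ) = ∑_{m=1}^n C_m(σ)`, the total number of cycles. -/
def totalCycles (n : ℕ) (σ : Equiv.Perm (Fin n)) : ℕ :=
  ∑ m ∈ Finset.Icc 1 n, cycleCount m σ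

/-- `∏_{m=1}^n F_m(C_m(σ))`. -/
def permWeight (F : ℕ → ℕ → ℝ) {n : ℕ} (σ : Equiv.Perm (Fin n)) : ℝ :=
  ∏ m ∈ Finset.Icc 1 n, F m (cycleCount m σ)

/-- The normalization constant `h_n(F) = (1/n!) ∑_σ ∏_m F_m(C_m(σ))`. -/
def normConst (F : ℕ → ℕ → ℝ) (n : ℕ) : ℝ :=
  (1 / (n.factorial : ℝ)) * ∑ σ : Equiv.Perm (Fin n), permWeight F σ

/-- The finite set `S_n` carries the discrete sigma-algebra. -/
instance permMeasurableSpace (n : ℕ) : MeasurableSpace (Equiv.Perm (Fin n)) := ⊤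

/-- The generalized weighted measure on `S_n`:
`P_n[σ] = (1 / (n! h_n(F))) ∏_{m=1}^n F_m(C_m(σ))`. -/
def weightedMeasure (F : ℕ → ℕ → ℝ) (n : ℕ) : Measure (Equiv.Perm (Fin n)) :=
  ∑ σ : Equiv.Perm (Fin n),
    ENNReal.ofReal (1 / ((n.factorial : ℝ) * normConst F n) * permWeight F σ) • Measure.dirac σ

/-! ### The class `F(r, θ)` -/

/-- `Δ₀(r, R, φ) = {z : |z| < R, z ≠ r, |arg (z - r)| > φ}`. -/
def Delta0 (r R φ : ℝ) : Set ℂ :=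
  {z | ‖z‖ < R ∧ z ≠ (r : ℂ) ∧ φ < |Complex.arg (z - r)|}

/-- The formal power series `g` is of class `F(r, θ)` with constant `K`: it is the expansion at `0`
of a function `G` holomorphic in some `Δ₀(r, R, φ)`, and
`G(t) = θ log (1 / (1 - t / r)) + K + O(t - r)` for `t → r` in `Δ₀(r, R, φ)`. -/
def IsClassFWith (g : PowerSeries ℂ) (r θ : ℝ) (K : ℂ) : Prop :=
  0 < r ∧ 0 ≤ θ ∧ ∃ R φ : ℝ, r < R ∧ 0 < φ ∧ φ < Real.pi / 2 ∧
    ∃ G : ℂ → ℂ,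
      DifferentiableOn ℂ G (Delta0 r R φ) ∧
      (∀ᶠ t in 𝓝 (0 : ℂ), HasSum (fun m : ℕ => PowerSeries.coeff m g * t ^ m) (G t)) ∧
      (fun t : ℂ => G t - ((θ : ℂ) * Complex.log (1 / (1 - t / (r : ℂ))) + K))
        =O[𝓝[Delta0 r R φ] (r : ℂ)] (fun t : ℂ => t - (r : ℂ))

/-- The formal power series `g` is of class `F(r, θ)`. -/
def IsClassF (g : PowerSeries ℂ) (r θ : ℝ) : Prop :=
  ∃ K : ℂ, IsClassFWith g r θ K

/-! ### Strong mod-Poisson convergence -/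

/-- The random variables `Z n` on the probability spaces `(Ω n, μ n)` converge in the strong
mod-Poisson sense with parameters `lam n` and limiting function `Ψ`. -/
def StrongModPoisson {Ω : ℕ → Type} [∀ n, MeasurableSpace (Ω n)] (μ : ∀ n, Measure (Ω n))
    (Z : ∀ n, Ω n → ℝ) (lam : ℕ → ℝ) (Ψ : ℝ → ℂ) : Prop :=
  (∀ n, IsProbabilityMeasure (μ n)) ∧ (∀ n, Measurable (Z n)) ∧
  Continuous Ψ ∧ Ψ 0 = 1 ∧
  TendstoLocallyUniformly
    (fun (n : ℕ) (s : ℝ) =>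
      Complex.exp ((lam n : ℂ) * (1 - Complex.exp (Complex.I * s))) *
        ∫ ω, Complex.exp (Complex.I * s * (Z n ω : ℂ)) ∂(μ n))
    Ψ atTop

/-! ### The spatial measure -/

variable {d : ℕ}

/-- `∫ e^{-ξ(x)} e^{-2πi⟨k,x⟩} dx`. -/
def spatialFourier (ξ : EuclideanSpace ℝ (Fin d) → ℝ) (k : EuclideanSpace ℝ (Fin d)) : ℂ :=
  ∫ x : EuclideanSpace ℝ (Fin d),
    Complex.exp (-(ξ x : ℂ)) * Complex.exp (-(2 * Real.pi * Complex.I * (inner ℝ k x : ℝ)))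

/-- The number `e^{-ε(k)}`: the value of `∫ e^{-ξ(x)} e^{-2πi⟨k,x⟩} dx`, for `k` where this is
real (see `IsAdmissible`). The value `0`, that is `ε(k) = ∞`, is allowed. -/
def expNegEps (ξ : EuclideanSpace ℝ (Fin d) → ℝ) (k : EuclideanSpace ℝ (Fin d)) : ℝ :=
  (spatialFourier ξ k).re

/-- The standing assumptions on `ξ` and `Λ`: `ξ` is continuous, `e^{-ξ}` is integrable,
`e^{-ε(k)}` is real and nonnegative for `k ∈ Λ`, and `∑_{k ∈ Λ} e^{-ε(k)} < ∞`. -/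
structure IsAdmissible (ξ : EuclideanSpace ℝ (Fin d) → ℝ)
    (Λ : Submodule ℤ (EuclideanSpace ℝ (Fin d))) : Prop where
  continuous : Continuous ξ
  integrable : Integrable (fun x => Real.exp (-ξ x))
  real : ∀ k ∈ Λ, (spatialFourier ξ k).im = 0
  nonneg : ∀ k ∈ Λ, 0 ≤ expNegEps ξ k
  summable : Summable (fun k : Λ => expNegEps ξ k)

/-- `F_m(c) = (e^{-α_m} ∑_{k ∈ Λ} e^{-ε(k) m})^c`. -/
def spatialF (a : ℕ → ℝ) (ξ : EuclideanSpace ℝ (Fin d) → ℝ)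
    (Λ : Submodule ℤ (EuclideanSpace ℝ (Fin d))) (m c : ℕ) : ℝ :=
  (Real.exp (-a m) * ∑' k : Λ, expNegEps ξ k ^ m) ^ c

/-- The spatial measure on `S_n`. -/
def spatialMeasure (a : ℕ → ℝ) (ξ : EuclideanSpace ℝ (Fin d) → ℝ)
    (Λ : Submodule ℤ (EuclideanSpace ℝ (Fin d))) (n : ℕ) : Measure (Equiv.Perm (Fin n)) :=
  weightedMeasure (spatialF a ξ Λ) n

/-- `g^{(α)}(t) = ∑_{m ≥ 1} (e^{-α_m} / m) t^m`. -/
def gAlpha (a : ℕ → ℝ) : PowerSeries ℂ :=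
  PowerSeries.mk fun m => if m = 0 then 0 else ((Real.exp (-a m) / m : ℝ) : ℂ)

/-- `g^{(α,ξ)}(t) = ∑_{k ∈ Λ} g^{(α)}(e^{-ε(k)} t)` as a formal power series: the coefficient of
`t^m` is `∑_{k ∈ Λ} (e^{-α_m} / m) (e^{-ε(k)})^m` for `m ≥ 1`. -/
def gAlphaXi (a : ℕ → ℝ) (ξ : EuclideanSpace ℝ (Fin d) → ℝ)
    (Λ : Submodule ℤ (EuclideanSpace ℝ (Fin d))) : PowerSeries ℂ :=
  PowerSeries.mk fun m =>
    if m = 0 then 0 else ((∑' k : Λ, Real.exp (-a m) / m * expNegEps ξ k ^ m : ℝ) : ℂ)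

/-- `r̃ = min {e^{ε(k)} : k ∈ Λ}`; the `k` with `e^{-ε(k)} = 0`, that is `e^{ε(k)} = ∞`, are
irrelevant for the minimum. -/
def rTilde (ξ : EuclideanSpace ℝ (Fin d) → ℝ)
    (Λ : Submodule ℤ (EuclideanSpace ℝ (Fin d))) : ℝ :=
  sInf {x : ℝ | ∃ k ∈ Λ, 0 < expNegEps ξ k ∧ x = (expNegEps ξ k)⁻¹}

/-- `A = #{k ∈ Λ : e^{ε(k)} = r̃}`. -/
def minCount (ξ : EuclideanSpace ℝ (Fin d) → ℝ)
    (Λ : Submodule ℤ (EuclideanSpace ℝ (Fin d))) : ℕ :=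
  Set.ncard {k | k ∈ Λ ∧ 0 < expNegEps ξ k ∧ (expNegEps ξ k)⁻¹ = rTilde ξ Λ}

end SpatialPerm

end

/-! The exponential formula makes the characteristic function of `K_{0n}` a quotient of power series
coefficients: `[t^n] exp(w g)` at `w = e^{is}` over the same coefficient at `w = 1`, where `g =
g^{(α,ξ)}` (`iteratedDeriv_exp_of_hasSum`, `charFun_totalCycles`).

Since `e^{-ξ} > 0`, the values `e^{-ε(k)}` have a strict maximum `e` at `k = 0`. Hence `r̃ = 1/e`
and `A = 1`, and summability leaves a gap below `e`. The terms `k ≠ 0` of `g` therefore sum to a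
function holomorphic beyond the singularity `ρ = r/e`; they change only the constant `K`
(`exists_isClassFWith_gAlphaXi`).

Near `ρ`, `exp(w g)` behaves like `e^{wK} (1 - t/ρ)^{-αw}`, whose coefficients are about `ρ^{-n}
e^{wK} n^{αw-1} / Γ(αw)`. The error function is `O(|1 - t/ρ|^{1 - α Re w})`, and the transfer
theorem `exists_norm_coeff_le` makes its coefficients smaller by a factor `n`, uniformly for `|w| =
1`. The quotient is then `exp((K + α log n)(w - 1)) (Γ(α)/Γ(αw) + o(1))`.

The transfer uses no Hankel contour: Cauchy estimates on discs of radius proportional to `|1 - t|`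
bound a high derivative inside the unit disc, and a circle average evaluated with the Poisson kernel
bounds the coefficients of that derivative. -/

noncomputable section

namespace SpatialPerm

/-! ### The cycle index recurrence -/

/-- The weight `∏_m (x_m / m)^{c_m} / c_m!` of a multiset with multiplicities `c_m`. -/
def partsWeight (x : ℕ → ℂ) (s : Multiset ℕ) : ℂ :=
  ∏ m ∈ s.toFinset, (x m / m) ^ s.count m / ((s.count m).factorial : ℂ)

theorem partsWeight_eq_prod (x : ℕ → ℂ) (s : Multiset ℕ) (T : Finset ℕ) (h : s.toFinset ⊆ T) :
    partsWeight x s = ∏ m ∈ T, (x m / m) ^ s.count m / ((s.count m).factorial : ℂ) := by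
  refine Finset.prod_subset h fun m _ hm => ?_
  simp [Multiset.count_eq_zero_of_notMem (mt Multiset.mem_toFinset.2 hm)]

/-- One more part `a` changes the weight by the factor `(x_a / a) / c_a`, with `c_a` the new
multiplicity. -/
theorem partsWeight_cons (x : ℕ → ℂ) (s : Multiset ℕ) {a : ℕ} (ha : a ≠ 0) :
    ((a : ℂ) * ((a ::ₘ s).count a : ℂ)) * partsWeight x (a ::ₘ s) = x a * partsWeight x s := by
  have hmem : a ∈ (a ::ₘ s).toFinset := by simp
  rw [partsWeight, partsWeight_eq_prod x s (a ::ₘ s).toFinset (by simp),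
    ← Finset.mul_prod_erase _ _ hmem, ← Finset.mul_prod_erase _ _ hmem]
  have : ∏ m ∈ (a ::ₘ s).toFinset.erase a,
      (x m / m) ^ (a ::ₘ s).count m / (((a ::ₘ s).count m).factorial : ℂ) =
      ∏ m ∈ (a ::ₘ s).toFinset.erase a, (x m / m) ^ s.count m / ((s.count m).factorial : ℂ) := by
    refine Finset.prod_congr rfl fun m hm => ?_
    rw [Multiset.count_cons_of_ne (Finset.ne_of_mem_erase hm)]
  rw [this, Multiset.count_cons_self, Nat.factorial_succ]
  have h1 : (a : ℂ) ≠ 0 := by exact_mod_cast ha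
  have h2 : ((s.count a : ℂ) + 1) ≠ 0 := by exact_mod_cast Nat.succ_ne_zero (s.count a)
  have h3 : ((s.count a).factorial : ℂ) ≠ 0 := by exact_mod_cast Nat.factorial_ne_zero _
  push_cast
  field_simp
  rw [pow_succ]
  field_simp

/-- The sum of `partsWeight` over the partitions of `n`. -/
def partitionSum (x : ℕ → ℂ) (n : ℕ) : ℂ := ∑ p : n.Partition, partsWeight x p.parts

/-- Write `n = ∑ m c_m` and exchange sums; deleting one part `m` is a bijection from the partitions
of `n` containing `m` to the partitions of `n - m`. -/
theorem natCast_mul_partitionSum (x : ℕ → ℂ) (n : ℕ) :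
    (n : ℂ) * partitionSum x n = ∑ m ∈ Finset.Icc 1 n, x m * partitionSum x (n - m) := by
  have h1 : ∀ p : n.Partition, (n : ℂ) * partsWeight x p.parts =
      ∑ m ∈ Finset.Icc 1 n, ((m : ℂ) * (p.parts.count m : ℂ)) * partsWeight x p.parts := by
    intro p
    rw [← Finset.sum_mul]
    congr 1
    have := Finset.sum_multiset_count_of_subset p.parts (Finset.Icc 1 n) (fun m hm => by
      rw [Multiset.mem_toFinset] at hm
      exact Finset.mem_Icc.2 ⟨p.parts_pos hm, p.le_of_mem_parts hm⟩)
    rw [p.parts_sum] at this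
    conv_lhs => rw [this]
    push_cast
    exact Finset.sum_congr rfl fun m _ => by simp [mul_comm]
  rw [partitionSum, Finset.mul_sum, Finset.sum_congr rfl fun p _ => h1 p, Finset.sum_comm]
  refine Finset.sum_congr rfl fun m hm => ?_
  obtain ⟨hm1, hmn⟩ := Finset.mem_Icc.1 hm
  rw [partitionSum, Finset.mul_sum,
    ← Equiv.sum_comp (Nat.Partition.partitionWithPartEquiv hm1 hmn)
      (fun q => x m * partsWeight x q.parts),
    ← Finset.sum_filter_of_ne (p := fun p : n.Partition => m ∈ p.parts) (fun p _ hp => by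
      by_contra h
      simp [Multiset.count_eq_zero_of_notMem h] at hp),
    Finset.sum_subtype (p := fun p : n.Partition => m ∈ p.parts) _ (by simp)]
  refine Finset.sum_congr rfl fun p _ => ?_
  rw [Nat.Partition.partitionWithPartEquiv_apply_parts,
    ← partsWeight_cons x _ (show m ≠ 0 by omega), Multiset.cons_erase p.2]

/-- `cycleType` omits fixed points, so `p` is split into its parts `≥ 2` and its ones; the number of
ones is forced by the total, and the known count by `cycleType` applies. -/
theorem card_partition_eq {α : Type*} [Fintype α] [DecidableEq α]
    (p : (Fintype.card α).Partition) :
    (Finset.univ.filter fun σ : Equiv.Perm α => σ.partition = p).card *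
      ∏ m ∈ p.parts.toFinset, m ^ p.parts.count m * (p.parts.count m).factorial =
      (Fintype.card α).factorial := by
  have hsplit : p.parts = p.parts.filter (2 ≤ ·) + Multiset.replicate (p.parts.count 1) 1 := by
    ext a
    rw [Multiset.count_add, Multiset.count_filter, Multiset.count_replicate]
    rcases Nat.lt_or_ge a 2 with h | h
    · interval_cases a
      · simpa using Multiset.count_eq_zero_of_notMem fun h0 => (p.parts_pos h0).ne rfl
      · simp
    · simp [h, show ¬ 1 = a by omega]
  have hsum : (p.parts.filter (2 ≤ ·)).sum + p.parts.count 1 = Fintype.card α := by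
    conv_rhs => rw [← p.parts_sum, hsplit]
    simp
  have hset : (Finset.univ.filter fun σ : Equiv.Perm α => σ.partition = p) =
      Finset.univ.filter fun σ : Equiv.Perm α => σ.cycleType = p.parts.filter (2 ≤ ·) := by
    ext σ
    simp only [Finset.mem_filter, Finset.mem_univ, true_and]
    refine ⟨fun h => by rw [← h, Equiv.Perm.filter_parts_partition_eq_cycleType], fun h => ?_⟩
    refine Nat.Partition.ext ?_
    rw [Equiv.Perm.parts_partition, ← Equiv.Perm.sum_cycleType, h,
      show Fintype.card α - (p.parts.filter (2 ≤ ·)).sum = p.parts.count 1 by omega, ← hsplit]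
  have := Equiv.Perm.card_of_cycleType_mul_eq α (p.parts.filter (2 ≤ ·))
  rw [if_pos ⟨by omega, fun a ha => (Multiset.mem_filter.1 ha).2⟩] at this
  rw [hset, ← this]
  congr 1
  have hs : Fintype.card α - (p.parts.filter (2 ≤ ·)).sum = p.parts.count 1 := by omega
  have hprod : (p.parts.filter (2 ≤ ·)).prod = p.parts.prod := by
    conv_rhs => rw [hsplit]
    simp
  have hfac : (p.parts.count 1).factorial * ∏ m ∈ (p.parts.filter (2 ≤ ·)).toFinset,
      ((p.parts.filter (2 ≤ ·)).count m).factorial =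
      ∏ m ∈ p.parts.toFinset, (p.parts.count m).factorial := by
    have herase : (p.parts.filter (2 ≤ ·)).toFinset = p.parts.toFinset.erase 1 := by
      ext a
      simp only [Multiset.mem_toFinset, Multiset.mem_filter, Finset.mem_erase]
      refine ⟨fun h => ⟨by omega, h.1⟩, fun h => ⟨h.2, ?_⟩⟩
      have := p.parts_pos h.2
      omega
    have hcount : ∀ m ∈ p.parts.toFinset.erase 1,
        ((p.parts.filter (2 ≤ ·)).count m).factorial = (p.parts.count m).factorial := by
      intro m hm
      rw [← herase, Multiset.mem_toFinset, Multiset.mem_filter] at hm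
      rw [Multiset.count_filter_of_pos hm.2]
    rw [herase, Finset.prod_congr rfl hcount]
    by_cases h1 : 1 ∈ p.parts.toFinset
    · exact Finset.mul_prod_erase _ (fun m => (p.parts.count m).factorial) h1
    · rw [Finset.erase_eq_of_notMem h1,
        Multiset.count_eq_zero_of_notMem (mt Multiset.mem_toFinset.2 h1)]
      simp
  rw [hs, hprod, Finset.prod_mul_distrib, ← hfac, ← Finset.prod_multiset_count]
  ring

/-- The cycle index `(1/n!) ∑_σ ∏_m x_m^{C_m(σ)}` of the symmetric group. -/
def cycleIndex (x : ℕ → ℂ) (n : ℕ) : ℂ :=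
  (1 / (n.factorial : ℂ)) *
    ∑ σ : Equiv.Perm (Fin n), ∏ m ∈ Finset.Icc 1 n, x m ^ cycleCount m σ

theorem cycleIndex_eq_partitionSum (x : ℕ → ℂ) (n : ℕ) :
    cycleIndex x n = partitionSum x n := by
  have hcard : Fintype.card (Fin n) = n := Fintype.card_fin n
  -- `σ.partition` is a partition of `Fintype.card (Fin n)`, which is not syntactically `n`.
  have key : partitionSum x n = partitionSum x (Fintype.card (Fin n)) := by rw [hcard]
  rw [key, cycleIndex, partitionSum]
  have h1 : ∀ σ : Equiv.Perm (Fin n), ∏ m ∈ Finset.Icc 1 n, x m ^ cycleCount m σ =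
      ∏ m ∈ σ.partition.parts.toFinset, x m ^ σ.partition.parts.count m := by
    intro σ
    symm
    refine Finset.prod_subset (fun m hm => ?_) fun m _ hm => ?_
    · rw [Multiset.mem_toFinset] at hm
      have := σ.partition.le_of_mem_parts hm
      exact Finset.mem_Icc.2 ⟨σ.partition.parts_pos hm, by omega⟩
    · simp [Multiset.count_eq_zero_of_notMem (mt Multiset.mem_toFinset.2 hm)]
  rw [Finset.sum_congr rfl fun σ _ => h1 σ, Finset.mul_sum,
    ← Finset.sum_fiberwise (s := Finset.univ) (g := fun σ : Equiv.Perm (Fin n) => σ.partition)]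
  refine Finset.sum_congr rfl fun p _ => ?_
  rw [Finset.sum_congr rfl (g := fun _ => 1 / (n.factorial : ℂ) *
    ∏ m ∈ p.parts.toFinset, x m ^ p.parts.count m)
    (fun σ hσ => by rw [(Finset.mem_filter.1 hσ).2]), Finset.sum_const, nsmul_eq_mul, partsWeight]
  have hc := card_partition_eq p
  rw [show (Fintype.card (Fin n)).factorial = n.factorial by rw [hcard]] at hc
  have hn : (n.factorial : ℂ) ≠ 0 := by exact_mod_cast n.factorial_ne_zero
  have hq : (∏ m ∈ p.parts.toFinset,
      ((m : ℂ) ^ p.parts.count m * ((p.parts.count m).factorial : ℂ))) ≠ 0 := by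
    refine Finset.prod_ne_zero_iff.2 fun m hm => mul_ne_zero (pow_ne_zero _ ?_) ?_
    · exact_mod_cast (p.parts_pos (Multiset.mem_toFinset.1 hm)).ne'
    · exact_mod_cast Nat.factorial_ne_zero _
  have hc' := congrArg (Nat.cast : ℕ → ℂ) hc
  push_cast at hc'
  have : ∏ m ∈ p.parts.toFinset, (x m / m) ^ p.parts.count m / ((p.parts.count m).factorial : ℂ) =
      (∏ m ∈ p.parts.toFinset, x m ^ p.parts.count m) / ∏ m ∈ p.parts.toFinset,
      ((m : ℂ) ^ p.parts.count m * ((p.parts.count m).factorial : ℂ)) := by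
    rw [← Finset.prod_div_distrib]
    exact Finset.prod_congr rfl fun m _ => by rw [div_pow, div_div]
  rw [this, ← hc']
  rw [← hc'] at hn
  have h2 := left_ne_zero_of_mul hn
  field_simp

theorem cycleIndex_zero (x : ℕ → ℂ) : cycleIndex x 0 = 1 := by
  simp [cycleIndex]

theorem natCast_mul_cycleIndex (x : ℕ → ℂ) (n : ℕ) :
    (n : ℂ) * cycleIndex x n = ∑ m ∈ Finset.Icc 1 n, x m * cycleIndex x (n - m) := by
  simp only [cycleIndex_eq_partitionSum, natCast_mul_partitionSum]

/-! ### Taylor coefficients -/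

theorem hasFPowerSeriesAt_of_hasSum {c : ℕ → ℂ} {f : ℂ → ℂ}
    (h : ∀ᶠ t in 𝓝 (0 : ℂ), HasSum (fun m => c m * t ^ m) (f t)) :
    HasFPowerSeriesAt f (FormalMultilinearSeries.ofScalars ℂ c) 0 := by
  rw [hasFPowerSeriesAt_iff]
  filter_upwards [h] with t ht
  simpa [FormalMultilinearSeries.coeff_ofScalars, mul_comm] using ht

theorem iteratedDeriv_of_hasSum {c : ℕ → ℂ} {f : ℂ → ℂ}
    (h : ∀ᶠ t in 𝓝 (0 : ℂ), HasSum (fun m => c m * t ^ m) (f t)) (n : ℕ) :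
    iteratedDeriv n f 0 = n.factorial * c n := by
  obtain ⟨r, hr⟩ := hasFPowerSeriesAt_of_hasSum h
  have := hr.factorial_smul 1 n
  rw [iteratedDeriv_eq_iteratedFDeriv, ← this]
  simp [FormalMultilinearSeries.ofScalars]

/-- The Taylor coefficients of `exp f` at `0` are the cycle indices in the variables `m c_m`. -/
theorem iteratedDeriv_exp_of_hasSum {c : ℕ → ℂ} {f : ℂ → ℂ}
    (h : ∀ᶠ t in 𝓝 (0 : ℂ), HasSum (fun m => c m * t ^ m) (f t)) (hc : c 0 = 0) (n : ℕ) :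
    iteratedDeriv n (fun t => Complex.exp (f t)) 0 =
      n.factorial * cycleIndex (fun m => m * c m) n := by
  have hf : AnalyticAt ℂ f 0 := (hasFPowerSeriesAt_of_hasSum h).analyticAt
  have hexp : AnalyticAt ℂ (fun t => Complex.exp (f t)) 0 := hf.cexp
  have hderiv : deriv (fun t => Complex.exp (f t)) =ᶠ[𝓝 0]
      fun t => Complex.exp (f t) * deriv f t := by
    filter_upwards [hf.eventually_analyticAt] with t ht
    exact ht.differentiableAt.hasDerivAt.cexp.deriv
  induction n using Nat.strong_induction_on with
  | _ n ih =>
    cases n with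
    | zero =>
      have h0 := iteratedDeriv_of_hasSum h 0
      simp only [iteratedDeriv_zero, hc, mul_zero] at h0
      simp [cycleIndex_zero, h0]
    | succ n =>
      -- The Leibniz rule for `(exp f)' = exp f * f'` is, after division by factorials, the
      -- recurrence `natCast_mul_cycleIndex`.
      rw [iteratedDeriv_succ', hderiv.iteratedDeriv_eq, iteratedDeriv_fun_mul
        hexp.contDiffAt hf.deriv.contDiffAt, Nat.factorial_succ, Nat.cast_mul, mul_assoc,
        mul_left_comm, natCast_mul_cycleIndex, Finset.mul_sum]
      refine Finset.sum_nbij' (fun i => n + 1 - i) (fun m => n + 1 - m) ?_ ?_ ?_ ?_ ?_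
      · intro i hi
        simp only [Finset.mem_range, Finset.mem_Icc] at hi ⊢
        omega
      · intro i hi
        simp only [Finset.mem_range, Finset.mem_Icc] at hi ⊢
        omega
      · intro i hi
        simp only [Finset.mem_range] at hi
        omega
      · intro i hi
        simp only [Finset.mem_Icc] at hi
        omega
      · intro i hi
        simp only [Finset.mem_range] at hi
        obtain ⟨k, rfl⟩ : ∃ k, n = i + k := ⟨n - i, by omega⟩
        rw [ih i (by omega), show i + k - i = k by omega, ← iteratedDeriv_succ',
          iteratedDeriv_of_hasSum h, show i + k + 1 - i = k + 1 by omega,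
          show i + k + 1 - (k + 1) = i by omega]
        have := Nat.add_choose_mul_factorial_mul_factorial i k
        rw [Nat.choose_symm_add.symm] at this
        have := congrArg (Nat.cast : ℕ → ℂ) this
        push_cast at this
        rw [← this, Nat.factorial_succ]
        push_cast
        ring

theorem one_sub_mem_slitPlane {t : ℂ} (ht : t ∈ Metric.ball (0 : ℂ) 1) :
    1 - t ∈ Complex.slitPlane := by
  refine Or.inl ?_
  have := (Complex.re_le_norm t).trans_lt (mem_ball_zero_iff.1 ht)
  simp only [Complex.sub_re, Complex.one_re]
  linarith

/-- Only the value at `0` is needed, but the induction has to differentiate the formula, so it is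
proved on the whole disc. -/
theorem iteratedDeriv_exp_neg_mul_log_one_sub (β : ℂ) (n : ℕ) :
    ∀ t ∈ Metric.ball (0 : ℂ) 1,
      iteratedDeriv n (fun t => Complex.exp (-β * Complex.log (1 - t))) t =
        (∏ j ∈ Finset.range n, (β + j)) * Complex.exp (-(β + n) * Complex.log (1 - t)) := by
  induction n with
  | zero => intro t _; simp
  | succ n ih =>
    intro t ht
    have hs := one_sub_mem_slitPlane ht
    rw [iteratedDeriv_succ, Filter.EventuallyEq.deriv_eq
      (Filter.eventuallyEq_of_mem (Metric.isOpen_ball.mem_nhds ht) ih)]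
    have hd : HasDerivAt (fun t => -(β + n) * Complex.log (1 - t))
        (-(β + n) * (-1 / (1 - t))) t :=
      (((hasDerivAt_id t).const_sub 1).clog hs).const_mul _
    have hne : 1 - t ≠ 0 := Complex.slitPlane_ne_zero hs
    rw [((hd.cexp).const_mul _).deriv, Finset.prod_range_succ, Nat.cast_succ,
      show -(β + (n + 1)) * Complex.log (1 - t) =
        -(β + n) * Complex.log (1 - t) - Complex.log (1 - t) by ring, Complex.exp_sub,
      Complex.exp_log hne]
    field_simp

theorem iteratedDeriv_exp_neg_mul_log_one_sub_zero (β : ℂ) (n : ℕ) :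
    iteratedDeriv n (fun t => Complex.exp (-β * Complex.log (1 - t))) 0 =
      ∏ j ∈ Finset.range n, (β + j) := by
  rw [iteratedDeriv_exp_neg_mul_log_one_sub β n 0 (by simp)]
  simp

/-! ### Rising factorials and the reciprocal Gamma function -/

/-- `β (β + 1) ⋯ (β + n - 1) / n! * n ^ (1 - β)`. -/
def invGammaSeq (n : ℕ) (β : ℂ) : ℂ :=
  (∏ j ∈ Finset.range n, (β + j)) / n.factorial * Complex.exp ((1 - β) * (Real.log n : ℂ))

theorem continuous_invGammaSeq (n : ℕ) : Continuous (invGammaSeq n) := by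
  unfold invGammaSeq
  fun_prop

theorem tendsto_invGammaSeq (β : ℂ) :
    Tendsto (fun n => invGammaSeq n β) atTop (𝓝 (Complex.Gamma β)⁻¹) := by
  by_cases hβ : ∃ m : ℕ, β = -m
  · obtain ⟨m, rfl⟩ := hβ
    -- `Complex.Gamma` has the default value `0` at its poles, so its inverse is the entire function
    -- `1/Γ` there too.
    rw [Complex.Gamma_neg_nat_eq_zero, inv_zero]
    refine tendsto_const_nhds.congr' ?_
    filter_upwards [eventually_gt_atTop m] with n hn
    rw [invGammaSeq, Finset.prod_eq_zero (Finset.mem_range.2 hn) (by simp)]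
    simp
  · have hne : ∀ j : ℕ, β + j ≠ 0 := fun j h => hβ ⟨j, eq_neg_of_add_eq_zero_left h⟩
    have hG : Complex.Gamma β ≠ 0 := Complex.Gamma_ne_zero fun m h => hβ ⟨m, h⟩
    have h1 := (Complex.GammaSeq_tendsto_Gamma β).inv₀ hG
    have h2 : Tendsto (fun n : ℕ => (n : ℂ) / (n + β)) atTop (𝓝 1) :=
      tendsto_natCast_div_add_atTop β
    have h3 := h1.mul h2
    rw [mul_one] at h3
    refine h3.congr' ?_
    filter_upwards [eventually_gt_atTop 0] with n hn
    have hn0 : (n : ℂ) ≠ 0 := by exact_mod_cast hn.ne'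
    have hf : (n.factorial : ℂ) ≠ 0 := by exact_mod_cast n.factorial_ne_zero
    have hlog : (Real.log n : ℂ) = Complex.log n := by
      rw [Complex.ofReal_log (Nat.cast_nonneg n), Complex.ofReal_natCast]
    have hprod : ∏ j ∈ Finset.range n, (β + j) ≠ 0 :=
      Finset.prod_ne_zero_iff.2 fun j _ => hne j
    have hj := hne n
    have hj' : (n : ℂ) + β ≠ 0 := by rwa [add_comm]
    have hpow : (n : ℂ) ^ β ≠ 0 := by simp [Complex.cpow_eq_zero_iff, hn0]
    rw [Complex.GammaSeq, invGammaSeq, hlog, mul_comm (1 - β), ← Complex.cpow_def_of_ne_zero hn0,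
      Complex.cpow_sub _ _ hn0, Complex.cpow_one, Finset.prod_range_succ]
    field_simp
    ring

theorem invGammaSeq_succ {n : ℕ} (hn : n ≠ 0) (β : ℂ) :
    invGammaSeq (n + 1) β = invGammaSeq n β *
      ((1 + β / n) * Complex.exp (-(β * (Real.log (1 + 1 / n) : ℂ)))) := by
  have hn0 : (n : ℂ) ≠ 0 := by exact_mod_cast hn
  have hn1 : (n : ℂ) + 1 ≠ 0 := by exact_mod_cast n.succ_ne_zero
  have hnR : (0 : ℝ) < n := by exact_mod_cast Nat.pos_of_ne_zero hn
  have hf : (n.factorial : ℂ) ≠ 0 := by exact_mod_cast n.factorial_ne_zero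
  have hlog : Real.log ((n + 1 : ℕ) : ℝ) = Real.log n + Real.log (1 + 1 / n) := by
    rw [← Real.log_mul hnR.ne' (by positivity)]
    congr 1
    push_cast
    field_simp
  have hexp : Complex.exp (Real.log (1 + 1 / n) : ℂ) = 1 + 1 / n := by
    rw [← Complex.ofReal_exp, Real.exp_log (by positivity)]
    push_cast
    rfl
  rw [invGammaSeq, invGammaSeq, hlog, Finset.prod_range_succ, Nat.factorial_succ,
    Complex.ofReal_add, Nat.cast_mul, Nat.cast_succ]
  rw [show (1 - β) * ((Real.log n : ℂ) + (Real.log (1 + 1 / n) : ℂ)) =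
    (1 - β) * (Real.log n : ℂ) + (Real.log (1 + 1 / n) : ℂ) + -(β * (Real.log (1 + 1 / n) : ℂ)) by
    ring, Complex.exp_add, Complex.exp_add, hexp]
  field_simp
  ring

/-- The first-order terms cancel because `log (1 + 1/n) = 1/n + O(1/n²)`. This makes consecutive
ratios of `invGammaSeq` summably close to `1`. -/
theorem norm_one_add_div_mul_exp_sub_one_le {B : ℝ} (hB : 0 ≤ B) {n : ℕ} (hn : n ≠ 0)
    (hBn : B ≤ n) {β : ℂ} (hβ : ‖β‖ ≤ B) :
    ‖(1 + β / n) * Complex.exp (-(β * (Real.log (1 + 1 / n) : ℂ))) - 1‖ ≤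
      (B + B ^ 2 + B ^ 2 * (1 + B)) * (1 / (n : ℝ) ^ 2) := by
  have hnR : (0 : ℝ) < n := by exact_mod_cast Nat.pos_of_ne_zero hn
  have hn1 : (1 : ℝ) ≤ n := by exact_mod_cast Nat.one_le_iff_ne_zero.2 hn
  set ℓ : ℝ := Real.log (1 + 1 / n) with hℓ
  have hℓ0 : 0 ≤ ℓ := Real.log_nonneg (by simp)
  have hℓ1 : ℓ ≤ 1 / n := by
    have := Real.log_le_sub_one_of_pos (show (0 : ℝ) < 1 + 1 / n by positivity)
    linarith
  have hℓ2 : 1 / n - ℓ ≤ 1 / (n : ℝ) ^ 2 := by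
    have h := Real.one_sub_inv_le_log_of_pos (show (0 : ℝ) < 1 + 1 / n by positivity)
    have h2 : (1 : ℝ) / n - (1 - (1 + 1 / (n : ℝ))⁻¹) ≤ 1 / (n : ℝ) ^ 2 := by
      have : (1 : ℝ) / n - (1 - (1 + 1 / (n : ℝ))⁻¹) = 1 / (n * (n + 1)) := by
        field_simp
        ring
      rw [this]
      exact one_div_le_one_div_of_le (by positivity) (by nlinarith)
    linarith
  set z : ℂ := β / n
  set y : ℂ := β * (ℓ : ℂ)
  have hz : ‖z‖ ≤ B * (1 / n) := by
    rw [norm_div, Complex.norm_natCast, div_eq_mul_one_div]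
    gcongr
  have hy : ‖y‖ ≤ B * (1 / n) := by
    rw [norm_mul, Complex.norm_real, Real.norm_of_nonneg hℓ0]
    gcongr
  have hBn1 : B * (1 / n) ≤ 1 := by
    rw [mul_one_div]
    exact div_le_one_of_le₀ hBn hnR.le
  have hzy : ‖z - y‖ ≤ B * (1 / (n : ℝ) ^ 2) := by
    have : z - y = β * ((1 / n - ℓ : ℝ) : ℂ) := by
      simp only [z, y]
      push_cast
      ring
    rw [this, norm_mul, Complex.norm_real, Real.norm_of_nonneg (by linarith)]
    gcongr
  have he : ‖Complex.exp (-y) - 1 - -y‖ ≤ (B * (1 / n)) ^ 2 := by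
    refine (Complex.norm_exp_sub_one_sub_id_le (by rw [norm_neg]; linarith)).trans ?_
    rw [norm_neg]
    gcongr
  have hdec : (1 + z) * Complex.exp (-y) - 1 =
      (z - y) - z * y + (Complex.exp (-y) - 1 - -y) * (1 + z) := by ring
  rw [hdec]
  calc ‖(z - y) - z * y + (Complex.exp (-y) - 1 - -y) * (1 + z)‖
      ≤ ‖z - y‖ + ‖z‖ * ‖y‖ + ‖Complex.exp (-y) - 1 - -y‖ * (1 + ‖z‖) := by
        refine (norm_add_le _ _).trans (add_le_add ((norm_sub_le _ _).trans ?_) ?_)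
        · rw [norm_mul]
        · rw [norm_mul]
          gcongr
          exact (norm_add_le _ _).trans (by simp)
    _ ≤ B * (1 / (n : ℝ) ^ 2) + (B * (1 / n)) * (B * (1 / n)) + (B * (1 / n)) ^ 2 * (1 + B) := by
        gcongr
        refine hz.trans ?_
        rw [mul_one_div]
        exact div_le_self hB hn1
    _ = (B + B ^ 2 + B ^ 2 * (1 + B)) * (1 / (n : ℝ) ^ 2) := by ring

/-- Consecutive differences are dominated by a summable sequence independent of `β`, since the
partial products stay bounded; the pointwise limit then becomes uniform. -/
theorem tendstoUniformlyOn_invGammaSeq (B : ℝ) :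
    TendstoUniformlyOn invGammaSeq (fun β => (Complex.Gamma β)⁻¹) atTop
      (Metric.closedBall 0 B) := by
  wlog hB : 0 ≤ B
  · rw [Metric.closedBall_eq_empty.2 (not_le.1 hB)]
    exact tendstoUniformlyOn_empty
  obtain ⟨N, hN⟩ := exists_nat_ge (max B 1)
  have hNB : B ≤ N := (le_max_left _ _).trans hN
  have hN1 : 1 ≤ N := by exact_mod_cast (le_max_right _ _).trans hN
  set C := B + B ^ 2 + B ^ 2 * (1 + B) with hC
  have hC0 : 0 ≤ C := by positivity
  set d : ℕ → ℝ := fun k => C * (1 / ((N + k : ℕ) : ℝ) ^ 2) with hd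
  have hd0 : ∀ k, 0 ≤ d k := fun k => by positivity
  have hds : Summable d := by
    have : Summable fun k : ℕ => 1 / (k : ℝ) ^ 2 := Real.summable_one_div_nat_pow.2 one_lt_two
    have := ((summable_nat_add_iff N).2 this).mul_left C
    simpa only [hd, add_comm N] using this
  obtain ⟨Q, hQ⟩ := (isCompact_closedBall (0 : ℂ) B).exists_bound_of_continuousOn
    (continuous_invGammaSeq N).continuousOn
  have hstep : ∀ k, ∀ β ∈ Metric.closedBall (0 : ℂ) B,
      ‖(1 + β / (N + k : ℕ)) * Complex.exp (-(β * (Real.log (1 + 1 / (N + k : ℕ)) : ℂ))) - 1‖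
        ≤ d k := by
    intro k β hβ
    refine norm_one_add_div_mul_exp_sub_one_le hB (by omega) ?_ (mem_closedBall_zero_iff.1 hβ)
    push_cast
    linarith [Nat.cast_nonneg (α := ℝ) k]
  have hbound : ∀ k, ∀ β ∈ Metric.closedBall (0 : ℂ) B,
      ‖invGammaSeq (N + k) β‖ ≤ Q * Real.exp (∑ i ∈ Finset.range k, d i) := by
    intro k β hβ
    induction k with
    | zero => simpa using hQ β hβ
    | succ k ih =>
      rw [← add_assoc, invGammaSeq_succ (by omega), norm_mul, Finset.sum_range_succ, Real.exp_add,
        ← mul_assoc]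
      refine mul_le_mul ih ?_ (norm_nonneg _) ((norm_nonneg _).trans ih)
      have h1 := norm_add_le ((1 + β / (N + k : ℕ)) *
        Complex.exp (-(β * (Real.log (1 + 1 / (N + k : ℕ)) : ℂ))) - 1) 1
      rw [sub_add_cancel, norm_one] at h1
      linarith [hstep k β hβ, Real.add_one_le_exp (d k)]
  have hQ0 : 0 ≤ Q := (norm_nonneg _).trans (hQ 0 (by simpa using hB))
  set M := Q * Real.exp (∑' i, d i) with hM
  have hbound' : ∀ k, ∀ β ∈ Metric.closedBall (0 : ℂ) B, ‖invGammaSeq (N + k) β‖ ≤ M := by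
    intro k β hβ
    refine (hbound k β hβ).trans ?_
    rw [hM]
    gcongr
    exact hds.sum_le_tsum _ fun i _ => hd0 i
  have hdist : ∀ β ∈ Metric.closedBall (0 : ℂ) B, ∀ k,
      dist (invGammaSeq (N + k) β) (invGammaSeq (N + k.succ) β) ≤ M * d k := by
    intro β hβ k
    rw [dist_comm, dist_eq_norm, Nat.succ_eq_add_one, ← add_assoc, invGammaSeq_succ (by omega),
      ← mul_sub_one, norm_mul]
    exact mul_le_mul (hbound' k β hβ) (hstep k β hβ) (norm_nonneg _)
      ((norm_nonneg _).trans (hbound' k β hβ))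
  rw [Metric.tendstoUniformlyOn_iff]
  intro ε hε
  have htail := tendsto_sum_nat_add fun k => M * d k
  obtain ⟨n₀, hn₀⟩ := eventually_atTop.1 (htail.eventually (gt_mem_nhds hε))
  filter_upwards [eventually_ge_atTop (N + n₀)] with n hn β hβ
  obtain ⟨k, rfl⟩ : ∃ k, n = N + k := ⟨n - N, by omega⟩
  have hlim : Tendsto (fun k => invGammaSeq (N + k) β) atTop (𝓝 (Complex.Gamma β)⁻¹) := by
    simpa only [add_comm N] using (tendsto_add_atTop_iff_nat N).2 (tendsto_invGammaSeq β)
  have := dist_le_tsum_of_dist_le_of_tendsto _ (hdist β hβ) (hds.mul_left M) hlim k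
  rw [dist_comm]
  refine this.trans_lt ?_
  simpa only [add_comm k] using hn₀ k (by omega)

/-! ### Indented discs -/

/-- Cosine is decreasing on `[0, π]`, and the strict inequality already excludes `z = r`. In this
form openness and scaling need no arguments of complex numbers. -/
theorem Delta0_eq {r R φ : ℝ} (h0 : 0 < φ) (hπ : φ < Real.pi / 2) :
    Delta0 r R φ = {z | ‖z‖ < R ∧ (z - (r : ℂ)).re < Real.cos φ * ‖z - (r : ℂ)‖} := by
  ext z
  simp only [Delta0, Set.mem_ofPred_eq, and_congr_right_iff]
  intro _
  by_cases hz : z = r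
  · simp [hz]
  have hz' : z - r ≠ 0 := sub_ne_zero.2 hz
  have hpos : 0 < ‖z - r‖ := norm_pos_iff.2 hz'
  rw [← div_lt_iff₀ hpos, ← Complex.cos_arg hz', ← Real.cos_abs (Complex.arg _),
    Real.strictAntiOn_cos.lt_iff_gt ⟨abs_nonneg _, Complex.abs_arg_le_pi _⟩
      ⟨h0.le, by linarith [Real.pi_pos]⟩]
  simp [hz]

theorem isOpen_Delta0 {r R φ : ℝ} (h0 : 0 < φ) (hπ : φ < Real.pi / 2) :
    IsOpen (Delta0 r R φ) := by
  rw [Delta0_eq h0 hπ]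
  have h1 : IsOpen {z : ℂ | ‖z‖ < R} := isOpen_lt (by fun_prop) (by fun_prop)
  have h2 : IsOpen {z : ℂ | (z - (r : ℂ)).re < Real.cos φ * ‖z - (r : ℂ)‖} :=
    isOpen_lt (by fun_prop) (by fun_prop)
  exact h1.inter h2

/-- A closed disc of radius `R` about `0` indented at the point `1`, which is removed. -/
def indentedDisc (R c : ℝ) : Set ℂ := {u | ‖u‖ ≤ R ∧ u ≠ 1 ∧ (u - 1).re ≤ c * ‖u - 1‖}

theorem indentedDisc_subset_Delta0 {R R' c φ : ℝ} (h0 : 0 < φ) (hπ : φ < Real.pi / 2)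
    (hR : R' < R) (hc : c < Real.cos φ) : indentedDisc R' c ⊆ Delta0 1 R φ := by
  rw [Delta0_eq h0 hπ]
  rintro u ⟨h1, h2, h3⟩
  refine ⟨h1.trans_lt hR, ?_⟩
  have : 0 < ‖u - 1‖ := norm_pos_iff.2 (sub_ne_zero.2 h2)
  simp only [Complex.ofReal_one]
  nlinarith

/-- `O(t - 1)` near `1` improves to a uniform bound on a smaller indented disc. -/
theorem exists_norm_le_of_isBigO {R R' c φ : ℝ} (h0 : 0 < φ) (hπ : φ < Real.pi / 2)
    (hR : R' < R) (hc : c < Real.cos φ) {V : ℂ → ℂ} (hV : ContinuousOn V (Delta0 1 R φ))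
    (hO : V =O[𝓝[Delta0 1 R φ] 1] fun t => t - 1) :
    ∃ M : ℝ, 0 ≤ M ∧ ∀ u ∈ indentedDisc R' c, ‖V u‖ ≤ M * ‖1 - u‖ := by
  have hsub := indentedDisc_subset_Delta0 h0 hπ hR hc
  obtain ⟨C, hC⟩ := hO.bound
  obtain ⟨η, hη, hball⟩ := Metric.mem_nhdsWithin_iff.1 hC
  have hcl1 : IsClosed {u : ℂ | (u - 1).re ≤ c * ‖u - 1‖} :=
    isClosed_le (by fun_prop) (by fun_prop)
  have hcl2 : IsClosed {u : ℂ | η ≤ ‖u - 1‖} := isClosed_le (by fun_prop) (by fun_prop)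
  -- Away from `1` the smaller region is compact, so `V` is bounded there by some `M₀`, and `M₀ ≤
  -- (M₀ / η) * ‖u - 1‖`.
  have hcomp : IsCompact (Metric.closedBall (0 : ℂ) R' ∩
      ({u : ℂ | (u - 1).re ≤ c * ‖u - 1‖} ∩ {u : ℂ | η ≤ ‖u - 1‖})) :=
    (isCompact_closedBall (0 : ℂ) R').inter_right (hcl1.inter hcl2)
  obtain ⟨M₀, hM₀⟩ := hcomp.exists_bound_of_continuousOn (hV.mono fun u hu => hsub
    ⟨mem_closedBall_zero_iff.1 hu.1, fun h => by
      have : η ≤ ‖u - 1‖ := hu.2.2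
      rw [h, sub_self, norm_zero] at this
      linarith, hu.2.1⟩)
  refine ⟨max 0 (max C (M₀ / η)), le_max_left _ _, fun u hu => ?_⟩
  rw [norm_sub_rev 1 u]
  by_cases h : ‖u - 1‖ < η
  · refine (hball ⟨by simpa [dist_eq_norm] using h, hsub hu⟩).trans ?_
    gcongr
    exact (le_max_left _ _).trans (le_max_right _ _)
  · push Not at h
    have hM := hM₀ u ⟨mem_closedBall_zero_iff.2 hu.1, hu.2.2, h⟩
    have hM0 : 0 ≤ M₀ := (norm_nonneg _).trans hM
    calc ‖V u‖ ≤ M₀ := hM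
      _ = M₀ / η * η := by field_simp
      _ ≤ max 0 (max C (M₀ / η)) * ‖u - 1‖ := by
        gcongr
        exact (le_max_right _ _).trans (le_max_right _ _)

/-- Since `Re (t - 1) ≤ 0`, a point `u` of the disc has `Re (u - 1) ≤ δ|1 - t|`, while `|u - 1| ≥ (1
- δ)|1 - t|`. These are the discs for the Cauchy estimates. -/
theorem closedBall_subset_indentedDisc {δ R c : ℝ} (hδ : 0 < δ) (hδ1 : δ ≤ 1 / 2)
    (hR : 1 + 2 * δ ≤ R) (hc : δ ≤ c * (1 - δ)) {t : ℂ} (ht : t ∈ Metric.ball (0 : ℂ) 1) :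
    Metric.closedBall t (δ * ‖1 - t‖) ⊆ indentedDisc R c := by
  rw [mem_ball_zero_iff] at ht
  have hne : 1 - t ≠ 0 := fun h => by
    rw [← sub_eq_zero.1 h] at ht
    simp at ht
  have hpos : 0 < ‖1 - t‖ := norm_pos_iff.2 hne
  have hle : ‖1 - t‖ ≤ 2 := (norm_sub_le _ _).trans (by rw [norm_one]; linarith)
  intro u hu
  rw [mem_closedBall_iff_norm] at hu
  have hlow : (1 - δ) * ‖1 - t‖ ≤ ‖u - 1‖ := by
    have : ‖1 - t‖ ≤ ‖u - t‖ + ‖u - 1‖ := by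
      have := norm_sub_le (u - t) (u - 1)
      rwa [show u - t - (u - 1) = 1 - t by ring] at this
    linarith
  have hc0 : 0 < c := by nlinarith
  refine ⟨?_, ?_, ?_⟩
  · have : ‖u‖ ≤ ‖t‖ + ‖u - t‖ := by
      have := norm_add_le t (u - t)
      rwa [add_sub_cancel] at this
    nlinarith
  · rintro rfl
    rw [sub_self, norm_zero] at hlow
    nlinarith
  · have h1 : (u - 1).re = (u - t).re + (t - 1).re := by
      simp only [Complex.sub_re]
      ring
    have h2 := Complex.re_le_norm (u - t)
    have h3 : (t - 1).re ≤ 0 := by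
      have := Complex.re_le_norm t
      simp only [Complex.sub_re, Complex.one_re]
      linarith
    have h4 : δ * ‖1 - t‖ ≤ c * ((1 - δ) * ‖1 - t‖) := by nlinarith
    have h5 : c * ((1 - δ) * ‖1 - t‖) ≤ c * ‖u - 1‖ := by gcongr
    linarith

/-! ### Transfer of singular behaviour to coefficients -/

theorem rpow_le_two_rpow_mul {a b q Q : ℝ} (hb : 0 < b) (h1 : b / 2 ≤ a) (h2 : a ≤ 2 * b)
    (hq : |q| ≤ Q) : a ^ q ≤ 2 ^ Q * b ^ q := by
  have ha : 0 < a := by linarith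
  have hratio : (a / b) ^ q ≤ 2 ^ Q := by
    have hlog : |Real.log (a / b)| ≤ Real.log 2 := by
      rw [abs_le, ← Real.log_inv]
      refine ⟨Real.log_le_log (by norm_num) ?_, Real.log_le_log (by positivity) ?_⟩
      · rw [le_div_iff₀ hb]
        linarith
      · rw [div_le_iff₀ hb]
        linarith
    rw [Real.rpow_def_of_pos (by positivity), Real.rpow_def_of_pos two_pos]
    refine Real.exp_le_exp.2 ((le_abs_self _).trans ?_)
    rw [abs_mul]
    exact mul_le_mul hlog hq (abs_nonneg _) ((abs_nonneg _).trans hlog)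
  calc a ^ q = (a / b) ^ q * b ^ q := by
        rw [← Real.mul_rpow (by positivity) hb.le, div_mul_cancel₀ _ hb.ne']
    _ ≤ 2 ^ Q * b ^ q := by gcongr

/-- Cauchy's estimate on the circle of radius `δ|1 - t|`, on which `|1 - u|` and `|1 - t|` agree up
to a factor `2`; the factor `2 ^ Q` serves both signs of `q`. -/
theorem norm_iteratedDeriv_le_of_indentedDisc {δ R c : ℝ} (hδ : 0 < δ) (hδ1 : δ ≤ 1 / 2)
    (hR : 1 + 2 * δ ≤ R) (hc : δ ≤ c * (1 - δ)) {E : ℂ → ℂ} {U : Set ℂ}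
    (hsub : indentedDisc R c ⊆ U) (hE : DifferentiableOn ℂ E U) {C q Q : ℝ} (hC : 0 ≤ C)
    (hq : |q| ≤ Q) (hb : ∀ u ∈ indentedDisc R c, ‖E u‖ ≤ C * ‖1 - u‖ ^ q) (k : ℕ) {t : ℂ}
    (ht : t ∈ Metric.ball (0 : ℂ) 1) :
    ‖iteratedDeriv k E t‖ ≤ k.factorial * C * 2 ^ Q / δ ^ k * ‖1 - t‖ ^ (q - k) := by
  have hcb := closedBall_subset_indentedDisc hδ hδ1 hR hc ht
  have hne : 1 - t ≠ 0 := Complex.slitPlane_ne_zero (one_sub_mem_slitPlane ht)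
  have hpos : 0 < ‖1 - t‖ := norm_pos_iff.2 hne
  have hr : 0 < δ * ‖1 - t‖ := by positivity
  have hd : DiffContOnCl ℂ E (Metric.ball t (δ * ‖1 - t‖)) := by
    refine DifferentiableOn.diffContOnCl (hE.mono ?_)
    rw [closure_ball _ hr.ne']
    exact hcb.trans hsub
  have hbound : ∀ u ∈ Metric.sphere t (δ * ‖1 - t‖),
      ‖E u‖ ≤ C * (2 ^ Q * ‖1 - t‖ ^ q) := by
    intro u hu
    refine (hb u (hcb (Metric.sphere_subset_closedBall hu))).trans ?_
    rw [mem_sphere_iff_norm] at hu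
    gcongr
    have h1 : ‖1 - t‖ ≤ ‖u - t‖ + ‖1 - u‖ := by
      have := norm_add_le (u - t) (1 - u)
      rwa [show u - t + (1 - u) = 1 - t by ring] at this
    have h2 : ‖1 - u‖ ≤ ‖1 - t‖ + ‖u - t‖ := by
      have := norm_sub_le (1 - t) (u - t)
      rwa [show 1 - t - (u - t) = 1 - u by ring] at this
    exact rpow_le_two_rpow_mul hpos (by nlinarith) (by nlinarith) hq
  refine (Complex.norm_iteratedDeriv_le_of_forall_mem_sphere_norm_le k hr hd hbound).trans_eq ?_
  rw [Real.rpow_sub hpos, Real.rpow_natCast, mul_pow]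
  field_simp

/-! ### Coefficient bounds from circle averages -/

theorem norm_one_sub_circleMap_neg (x θ : ℝ) :
    ‖1 - circleMap 0 x (-θ)‖ = ‖circleMap 0 1 θ - x‖ := by
  have h : (1 - circleMap 0 x (-θ)) * circleMap 0 1 θ = circleMap 0 1 θ - x := by
    have : Complex.exp (-(θ * Complex.I)) * Complex.exp (θ * Complex.I) = 1 := by
      rw [← Complex.exp_add]
      simp
    simp only [circleMap, zero_add, Complex.ofReal_one, one_mul, Complex.ofReal_neg, neg_mul]
    linear_combination (-(x : ℂ)) * this
  rw [← h, norm_mul]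
  simp [circleMap]

/-- The Poisson kernel `(1 - x²) / |e^{iθ} - x|²` has mean `1`; the reflection `θ ↦ -θ` brings it to
the form `|1 - x e^{iθ}|`. -/
theorem integral_inv_norm_one_sub_circleMap_sq {x : ℝ} (hx0 : 0 ≤ x) (hx1 : x < 1) :
    (2 * Real.pi)⁻¹ * ∫ θ in (0 : ℝ)..2 * Real.pi, (‖1 - circleMap 0 x θ‖ ^ 2)⁻¹ =
      (1 - x ^ 2)⁻¹ := by
  have hP := DiffContOnCl.circleAverage_poissonKernel_smul' (f := fun _ : ℂ => (1 : ℂ)) (c := 0)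
    (w := (x : ℂ)) (R := 1) diffContOnCl_const (by simpa [abs_of_nonneg hx0] using hx1)
  rw [Real.circleAverage] at hP
  simp only [sub_zero, norm_circleMap_zero, abs_one, one_pow, Complex.norm_real, Real.norm_eq_abs,
    sq_abs, Complex.real_smul, mul_one, intervalIntegral.integral_ofReal] at hP
  have hP' : (2 * Real.pi)⁻¹ * ∫ θ in (0 : ℝ)..2 * Real.pi,
      (1 - x ^ 2) / ‖circleMap 0 1 θ - x‖ ^ 2 = 1 := by exact_mod_cast hP
  have hx2 : 1 - x ^ 2 ≠ 0 := by nlinarith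
  have hneg : ∫ θ in (0 : ℝ)..2 * Real.pi, (‖1 - circleMap 0 x θ‖ ^ 2)⁻¹ =
      ∫ θ in (0 : ℝ)..2 * Real.pi, (‖circleMap 0 1 θ - x‖ ^ 2)⁻¹ := by
    simp only [← norm_one_sub_circleMap_neg]
    rw [intervalIntegral.integral_comp_neg (fun θ => (‖1 - circleMap 0 x θ‖ ^ 2)⁻¹)]
    have hper : Function.Periodic (fun θ => (‖1 - circleMap 0 x θ‖ ^ 2)⁻¹) (2 * Real.pi) := by
      intro θ
      simp only [periodic_circleMap 0 x θ]
    have := hper.intervalIntegral_add_eq 0 (-(2 * Real.pi))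
    simpa using this
  rw [hneg]
  simp only [div_eq_mul_inv, intervalIntegral.integral_const_mul] at hP'
  refine eq_inv_of_mul_eq_one_right ?_
  linear_combination hP'

/-- In Cauchy's integral over `|t| = x`, `p - 2` of the powers are estimated by `|1 - t| ≥ 1 - x`
and the other two are averaged exactly. The averaging saves one power of `1 - x` over the pointwise
bound. -/
theorem norm_iteratedDeriv_zero_le {f : ℂ → ℂ} (hf : DifferentiableOn ℂ f (Metric.ball 0 1))
    {C p : ℝ} (hC : 0 ≤ C) (hp : 2 ≤ p)
    (hb : ∀ t ∈ Metric.ball (0 : ℂ) 1, ‖f t‖ ≤ C * ‖1 - t‖ ^ (-p)) (m : ℕ) {x : ℝ} (hx0 : 0 < x)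
    (hx1 : x < 1) :
    ‖iteratedDeriv m f 0‖ ≤
      m.factorial * (C * (1 - x) ^ (2 - p) * (1 - x ^ 2)⁻¹ * x⁻¹ ^ m) := by
  have hsub : Metric.closedBall (0 : ℂ) x ⊆ Metric.ball 0 1 := Metric.closedBall_subset_ball hx1
  have hps : HasFPowerSeriesOnBall f (cauchyPowerSeries f 0 x) 0 (NNReal.mk x hx0.le) :=
    DifferentiableOn.hasFPowerSeriesOnBall (R := NNReal.mk x hx0.le) (hf.mono hsub) hx0
  have h1 : iteratedDeriv m f 0 = m.factorial • cauchyPowerSeries f 0 x m fun _ => 1 := by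
    rw [iteratedDeriv_eq_iteratedFDeriv, hps.factorial_smul 1 m]
  have h2 : ‖cauchyPowerSeries f 0 x m fun _ => 1‖ ≤ ‖cauchyPowerSeries f 0 x m‖ := by
    simpa only [norm_one, Finset.prod_const_one, mul_one] using
      (cauchyPowerSeries f 0 x m).le_opNorm fun _ => (1 : ℂ)
  rw [h1, nsmul_eq_mul, norm_mul, Complex.norm_natCast]
  gcongr
  refine h2.trans ((norm_cauchyPowerSeries_le f 0 x m).trans ?_)
  rw [abs_of_pos hx0, ← integral_inv_norm_one_sub_circleMap_sq hx0.le hx1, mul_left_comm]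
  gcongr ?_ * _
  gcongr
  rw [← intervalIntegral.integral_const_mul]
  have hmem : ∀ θ, circleMap 0 x θ ∈ Metric.ball (0 : ℂ) 1 := fun θ =>
    hsub (circleMap_mem_closedBall 0 hx0.le θ)
  have hcont : Continuous fun θ => f (circleMap 0 x θ) :=
    hf.continuousOn.comp_continuous (continuous_circleMap 0 x) hmem
  have hne : ∀ θ, 1 - circleMap 0 x θ ≠ 0 := fun θ =>
    Complex.slitPlane_ne_zero (one_sub_mem_slitPlane (hmem θ))
  have hcont2 : Continuous fun θ => (‖1 - circleMap 0 x θ‖ ^ 2)⁻¹ :=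
    Continuous.inv₀ (by fun_prop) fun θ => by simpa using hne θ
  refine intervalIntegral.integral_mono_on (by positivity)
    (hcont.norm.intervalIntegrable _ _) ((hcont2.const_mul _).intervalIntegrable _ _)
    fun θ _ => ?_
  refine (hb _ (hmem θ)).trans ?_
  have hpos : 0 < ‖1 - circleMap 0 x θ‖ := norm_pos_iff.2 (hne θ)
  have hge : 1 - x ≤ ‖1 - circleMap 0 x θ‖ := by
    have := norm_sub_norm_le 1 (circleMap 0 x θ)
    rwa [norm_one, norm_circleMap_zero, abs_of_pos hx0] at this
  rw [mul_assoc]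
  gcongr
  rw [show -p = (2 - p) + (-2) by ring, Real.rpow_add hpos, Real.rpow_neg hpos.le 2,
    Real.rpow_two]
  gcongr ?_ * _
  exact Real.rpow_le_rpow_of_nonpos (by linarith) hge (by linarith)

/-- Transfer theorem: a function which is `O(|1 - u| ^ q)` in an indented disc has Taylor
coefficients `O(n ^ (-q - 1))`, uniformly for bounded `q`. -/
theorem exists_norm_coeff_le {δ R c : ℝ} (hδ : 0 < δ) (hδ1 : δ ≤ 1 / 2)
    (hR : 1 + 2 * δ ≤ R) (hc : δ ≤ c * (1 - δ)) {U : Set ℂ}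
    (hsub : indentedDisc R c ⊆ U) {C Q : ℝ} (hC : 0 ≤ C) :
    ∃ A : ℝ, 0 ≤ A ∧ ∃ N : ℕ, ∀ q : ℝ, |q| ≤ Q → ∀ E : ℂ → ℂ, DifferentiableOn ℂ E U →
      (∀ u ∈ indentedDisc R c, ‖E u‖ ≤ C * ‖1 - u‖ ^ q) →
      ∀ n ≥ N, ‖iteratedDeriv n E 0 / (n.factorial : ℂ)‖ ≤ A * (n : ℝ) ^ (-q - 1) := by
  -- The choice gives `k - q ≥ 2` whenever `|q| ≤ Q`, as the circle average requires.
  set k : ℕ := ⌈Q⌉₊ + 2 with hk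
  set C₁ : ℝ := k.factorial * C * 2 ^ Q / δ ^ k with hC₁
  have hC₁0 : 0 ≤ C₁ := by positivity
  refine ⟨2 * 2 ^ k * 2 ^ (k + Q) * C₁, by positivity, 2 * k, fun q hq E hE hb n hn => ?_⟩
  have hqk : q + 2 ≤ k := by
    have := (le_abs_self q).trans (hq.trans (Nat.le_ceil Q))
    rw [hk]
    push_cast
    linarith
  have hball : Metric.ball (0 : ℂ) 1 ⊆ U := fun t ht => hsub
    (closedBall_subset_indentedDisc hδ hδ1 hR hc ht (Metric.mem_closedBall_self (by positivity)))
  have hf : DifferentiableOn ℂ (iteratedDeriv k E) (Metric.ball 0 1) := by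
    have := ((hE.mono hball).analyticOnNhd Metric.isOpen_ball).iterated_deriv k
    rw [← iteratedDeriv_eq_iterate] at this
    exact this.differentiableOn
  have hfb : ∀ t ∈ Metric.ball (0 : ℂ) 1,
      ‖iteratedDeriv k E t‖ ≤ C₁ * ‖1 - t‖ ^ (-((k : ℝ) - q)) := by
    intro t ht
    rw [neg_sub]
    exact norm_iteratedDeriv_le_of_indentedDisc hδ hδ1 hR hc hsub hE hC hq hb k ht
  have hn1 : 1 ≤ n := by omega
  have hnR : (1 : ℝ) ≤ n := by exact_mod_cast hn1
  have hn0 : (0 : ℝ) < n := by linarith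
  obtain ⟨m, rfl⟩ : ∃ m, n = m + k := ⟨n - k, by omega⟩
  have hit : iteratedDeriv (m + k) E 0 = iteratedDeriv m (iteratedDeriv k E) 0 := by
    simp only [iteratedDeriv_eq_iterate, Function.iterate_add_apply]
  set n := m + k with hnmk
  -- This radius keeps `x⁻¹ ^ m ≤ 2` by Bernoulli's inequality, while `1 - x` has order `1/n`.
  set x : ℝ := 1 - 1 / (2 * n) with hx
  have hinv : 1 / (2 * (n : ℝ)) ≤ 1 / 2 := one_div_le_one_div_of_le two_pos (by linarith)
  have hinv0 : 0 < 1 / (2 * (n : ℝ)) := by positivity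
  have hx0 : 0 < x := by linarith
  have hx1 : x < 1 := by linarith
  have hmain := norm_iteratedDeriv_zero_le hf hC₁0 (by linarith : 2 ≤ (k : ℝ) - q) hfb m hx0 hx1
  have hxm : x⁻¹ ^ m ≤ 2 := by
    have h1 : (1 : ℝ) / 2 ≤ x ^ n := by
      have := one_add_mul_le_pow (a := -(1 / (2 * (n : ℝ)))) (by linarith) n
      rw [← sub_eq_add_neg, ← hx] at this
      refine le_trans (le_of_eq ?_) this
      field_simp
      norm_num
    have h2 : x ^ n ≤ x ^ m := pow_le_pow_of_le_one hx0.le hx1.le (by omega)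
    rw [inv_pow]
    exact inv_le_of_inv_le₀ two_pos (by linarith)
  have hxx : (1 - x ^ 2)⁻¹ ≤ 2 * (n : ℝ) := by
    refine inv_le_of_inv_le₀ (by positivity) ?_
    rw [← one_div, show 1 / (2 * (n : ℝ)) = 1 - x by rw [hx]; ring]
    nlinarith
  -- Undoing the `k` derivatives gains `n ^ (-k)`; `n ≥ 2 * k` makes every factor of the falling
  -- factorial at least `n / 2`.
  have hfac : (m.factorial : ℝ) / n.factorial ≤ 2 ^ k / (n : ℝ) ^ k := by
    have h1 : n - k = m := by omega
    have h2 := Nat.factorial_mul_descFactorial (show k ≤ n by omega)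
    rw [h1] at h2
    have h3 := Nat.pow_sub_le_descFactorial n k
    have h4 : ((n : ℝ) / 2) ^ k ≤ n.descFactorial k := by
      refine le_trans ?_ (by exact_mod_cast h3 : ((n + 1 - k : ℕ) : ℝ) ^ k ≤ _)
      gcongr
      rw [div_le_iff₀ two_pos]
      exact_mod_cast (by omega : n ≤ (n + 1 - k) * 2)
    have hm0 : (0 : ℝ) < m.factorial := by exact_mod_cast m.factorial_pos
    rw [← h2, Nat.cast_mul, div_mul_cancel_left₀ hm0.ne']
    refine (inv_anti₀ (by positivity) h4).trans_eq ?_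
    rw [div_pow, inv_div]
  have hpow : (1 - x) ^ (2 - ((k : ℝ) - q)) * (2 * (n : ℝ)) ≤
      2 ^ (k + Q) * ((n : ℝ) ^ k * (n : ℝ) ^ (-q - 1)) := by
    have h1 : (1 - x) ^ (2 - ((k : ℝ) - q)) = (2 * (n : ℝ)) ^ (((k : ℝ) - q) - 2) := by
      rw [show 1 - x = (2 * (n : ℝ))⁻¹ by rw [hx]; ring, Real.inv_rpow (by positivity),
        ← Real.rpow_neg (by positivity), neg_sub]
    have h2 : (2 : ℝ) ^ (((k : ℝ) - q) - 1) ≤ 2 ^ (k + Q) :=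
      Real.rpow_le_rpow_of_exponent_le one_le_two (by linarith [neg_abs_le q])
    calc (1 - x) ^ (2 - ((k : ℝ) - q)) * (2 * (n : ℝ))
        = (2 * (n : ℝ)) ^ (((k : ℝ) - q) - 1) := by
          rw [h1, ← Real.rpow_add_one (by positivity)]
          congr 1
          ring
      _ = 2 ^ (((k : ℝ) - q) - 1) * ((n : ℝ) ^ k * (n : ℝ) ^ (-q - 1)) := by
          rw [Real.mul_rpow two_pos.le hn0.le, ← Real.rpow_natCast, ← Real.rpow_add hn0]
          congr 2
          ring
      _ ≤ _ := by gcongr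
  rw [norm_div, Complex.norm_natCast, hit]
  have h1x : 0 < 1 - x := by linarith
  have h1xx : 0 < 1 - x ^ 2 := by nlinarith
  calc ‖iteratedDeriv m (iteratedDeriv k E) 0‖ / n.factorial
      ≤ m.factorial * (C₁ * (1 - x) ^ (2 - ((k : ℝ) - q)) * (1 - x ^ 2)⁻¹ * x⁻¹ ^ m) /
          n.factorial := by gcongr
    _ ≤ m.factorial * (C₁ * (1 - x) ^ (2 - ((k : ℝ) - q)) * (2 * (n : ℝ)) * 2) / n.factorial := by
        gcongr
    _ = (m.factorial / n.factorial) * (C₁ * ((1 - x) ^ (2 - ((k : ℝ) - q)) * (2 * (n : ℝ))) * 2) := by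
        ring
    _ ≤ (2 ^ k / (n : ℝ) ^ k) *
          (C₁ * (2 ^ (k + Q) * ((n : ℝ) ^ k * (n : ℝ) ^ (-q - 1))) * 2) := by
        gcongr
    _ = 2 * 2 ^ k * 2 ^ (k + Q) * C₁ * (n : ℝ) ^ (-q - 1) := by
        field_simp

/-! ### Singularity analysis of `exp (w g)` -/

/-- The cut `[1, ∞)` of `log (1 - t)` lies in the removed sector. -/
theorem one_sub_mem_slitPlane_of_mem_Delta0 {R φ : ℝ} (h0 : 0 < φ) (hπ : φ < Real.pi / 2)
    {t : ℂ} (ht : t ∈ Delta0 1 R φ) : 1 - t ∈ Complex.slitPlane := by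
  rw [Delta0_eq h0 hπ] at ht
  have h := ht.2
  rw [Complex.ofReal_one] at h
  rw [Complex.mem_slitPlane_iff]
  by_contra! hcon
  obtain ⟨h1, h2⟩ := hcon
  simp only [Complex.sub_re, Complex.one_re, Complex.sub_im, Complex.one_im] at h1 h2
  have him : (t - 1).im = 0 := by
    simp only [Complex.sub_im, Complex.one_im]
    linarith
  have hre : (t - 1).re = ‖t - 1‖ := by
    rw [← Complex.abs_re_eq_norm.2 him, abs_of_nonneg]
    simp only [Complex.sub_re, Complex.one_re]
    linarith
  nlinarith [Real.cos_le_one φ, norm_nonneg (t - 1)]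

theorem zero_mem_Delta0 {r R φ : ℝ} (hr : 0 < r) (hR : r < R) (h0 : 0 < φ)
    (hπ : φ < Real.pi / 2) : (0 : ℂ) ∈ Delta0 r R φ := by
  rw [Delta0_eq h0 hπ]
  have hcos : 0 < Real.cos φ := Real.cos_pos_of_mem_Ioo ⟨by linarith, hπ⟩
  refine ⟨by simpa using hr.trans hR, ?_⟩
  simp only [zero_sub, Complex.neg_re, Complex.ofReal_re]
  have : 0 ≤ Real.cos φ * ‖-(r : ℂ)‖ := by positivity
  linarith

/-- With `V = G + θ log (1 - t) - K = O(t - 1)`, one has `exp (wG) = e^{wK} (1 - t)^{-θw} e^{wV}`.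
Replacing `e^{wV}` by `1` leaves explicit coefficients, governed by `invGammaSeq`, and an error `E
w` for the transfer theorem. -/
theorem tendstoUniformlyOn_cycleIndex_one {R φ θ : ℝ} {K : ℂ} {G : ℂ → ℂ} {c : ℕ → ℂ}
    (hR : 1 < R) (h0 : 0 < φ) (hπ : φ < Real.pi / 2) (hθ : 0 ≤ θ)
    (hG : DifferentiableOn ℂ G (Delta0 1 R φ))
    (hsum : ∀ᶠ t in 𝓝 (0 : ℂ), HasSum (fun m => c m * t ^ m) (G t)) (hc : c 0 = 0)
    (hO : (fun t : ℂ => G t - (θ * Complex.log (1 / (1 - t)) + K))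
      =O[𝓝[Delta0 1 R φ] 1] fun t => t - 1) :
    TendstoUniformlyOn (fun (n : ℕ) (w : ℂ) => cycleIndex (fun m => w * (m * c m)) n *
      Complex.exp ((1 - θ * w) * (Real.log n : ℂ)) * Complex.exp (-(w * K)))
      (fun w => (Complex.Gamma (θ * w))⁻¹) atTop (Metric.sphere 0 1) := by
  have hcos : 0 < Real.cos φ := Real.cos_pos_of_mem_Ioo ⟨by linarith, hπ⟩
  have hopen := isOpen_Delta0 (r := 1) (R := R) h0 hπ
  have hslit : ∀ t ∈ Delta0 1 R φ, 1 - t ∈ Complex.slitPlane := fun t ht =>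
    one_sub_mem_slitPlane_of_mem_Delta0 h0 hπ ht
  have h0mem : (0 : ℂ) ∈ Delta0 1 R φ := zero_mem_Delta0 one_pos hR h0 hπ
  have hlogd : DifferentiableOn ℂ (fun t : ℂ => Complex.log (1 - t)) (Delta0 1 R φ) :=
    DifferentiableOn.clog (by fun_prop) hslit
  set V : ℂ → ℂ := fun t => G t + θ * Complex.log (1 - t) - K with hV
  have hVd : DifferentiableOn ℂ V (Delta0 1 R φ) := (hG.add (hlogd.const_mul _)).sub_const _
  have hVO : V =O[𝓝[Delta0 1 R φ] 1] fun t => t - 1 := by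
    refine hO.congr' ?_ EventuallyEq.rfl
    filter_upwards [self_mem_nhdsWithin] with t ht
    rw [one_div, Complex.log_inv _ (Complex.mem_slitPlane_iff_arg.1 (hslit t ht)).1, hV]
    ring
  set cc : ℝ := Real.cos φ / 2 with hcc
  set R' : ℝ := (1 + R) / 2 with hR'
  -- The second bound gives `1 + 2δ ≤ R'`; the first and third give `δ ≤ cc (1 - δ)`.
  set δ : ℝ := min (1 / 2) (min ((R - 1) / 4) (cc / 2)) with hδdef
  have hδ : 0 < δ := by
    refine lt_min (by norm_num) (lt_min ?_ ?_)
    · linarith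
    · rw [hcc]
      linarith
  have hδ1 : δ ≤ 1 / 2 := min_le_left _ _
  have hδ2 : δ ≤ (R - 1) / 4 := (min_le_right _ _).trans (min_le_left _ _)
  have hδ3 : δ ≤ cc / 2 := (min_le_right _ _).trans (min_le_right _ _)
  have hRδ : 1 + 2 * δ ≤ R' := by linarith
  have hcδ : δ ≤ cc * (1 - δ) := by nlinarith
  have hsub : indentedDisc R' cc ⊆ Delta0 1 R φ :=
    indentedDisc_subset_Delta0 h0 hπ (by linarith) (by linarith)
  obtain ⟨M, hM0, hM⟩ := exists_norm_le_of_isBigO h0 hπ (by linarith : R' < R)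
    (by linarith : cc < Real.cos φ) hVd.continuousOn hVO
  set C : ℝ := Real.exp ‖K‖ * Real.exp (θ * Real.pi) * (M * Real.exp (M * (1 + R'))) with hC
  obtain ⟨A, hA0, N, hA⟩ := exists_norm_coeff_le hδ hδ1 hRδ hcδ hsub (C := C) (Q := 1 + θ)
    (by positivity)
  set E : ℂ → ℂ → ℂ := fun w u => Complex.exp (w * G u) -
    Complex.exp (w * K) * Complex.exp (-(θ * w) * Complex.log (1 - u)) with hE
  have hEd : ∀ w, DifferentiableOn ℂ (E w) (Delta0 1 R φ) := fun w =>
    (hG.const_mul w).cexp.sub ((hlogd.const_mul _).cexp.const_mul _)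
  have hre : ∀ w ∈ Metric.sphere (0 : ℂ) 1, |w.re| ≤ 1 ∧ |w.im| ≤ 1 := fun w hw => by
    rw [mem_sphere_zero_iff_norm] at hw
    exact ⟨hw ▸ Complex.abs_re_le_norm w, hw ▸ Complex.abs_im_le_norm w⟩
  have hEb : ∀ w ∈ Metric.sphere (0 : ℂ) 1, ∀ u ∈ indentedDisc R' cc,
      ‖E w u‖ ≤ C * ‖1 - u‖ ^ (1 - θ * w.re) := by
    intro w hw u hu
    have hw1 : ‖w‖ = 1 := mem_sphere_zero_iff_norm.1 hw
    have hne : 1 - u ≠ 0 := Complex.slitPlane_ne_zero (hslit u (hsub hu))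
    have hpos : 0 < ‖1 - u‖ := norm_pos_iff.2 hne
    have hEeq : E w u = Complex.exp (w * K) * Complex.exp (-(θ * w) * Complex.log (1 - u)) *
        (Complex.exp (w * V u) - 1) := by
      rw [mul_sub, mul_one, ← Complex.exp_add, ← Complex.exp_add]
      simp only [hE, hV]
      rw [← Complex.exp_add]
      congr 2
      ring
    have hb1 : ‖Complex.exp (w * K)‖ ≤ Real.exp ‖K‖ := by
      refine (Complex.norm_exp_le_exp_norm _).trans ?_
      rw [norm_mul, hw1, one_mul]
    -- The imaginary part of `w` contributes only a bounded factor, as the argument of `1 - u` is at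
    -- most `π`.
    have hb2 : ‖Complex.exp (-(θ * w) * Complex.log (1 - u))‖ ≤
        Real.exp (θ * Real.pi) * ‖1 - u‖ ^ (-(θ * w.re)) := by
      rw [Complex.norm_exp, Real.rpow_def_of_pos hpos, ← Real.exp_add]
      refine Real.exp_le_exp.2 ?_
      have h1 : (-(θ * w) * Complex.log (1 - u)).re =
          θ * (w.im * Complex.arg (1 - u)) + Real.log ‖1 - u‖ * -(θ * w.re) := by
        simp [Complex.log_re, Complex.log_im]
        ring
      rw [h1]
      gcongr
      refine (le_abs_self _).trans ?_
      rw [abs_mul]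
      calc |w.im| * |Complex.arg (1 - u)| ≤ 1 * Real.pi :=
            mul_le_mul (hre w hw).2 (Complex.abs_arg_le_pi _) (abs_nonneg _) zero_le_one
        _ = Real.pi := one_mul _
    have hVu := hM u hu
    have hu2 : ‖1 - u‖ ≤ 1 + R' := (norm_sub_le _ _).trans (by rw [norm_one]; linarith [hu.1])
    have hb3 : ‖Complex.exp (w * V u) - 1‖ ≤ M * ‖1 - u‖ * Real.exp (M * (1 + R')) := by
      have := Complex.norm_exp_sub_sum_le_norm_mul_exp (w * V u) 1
      simp only [Finset.range_one, Finset.sum_singleton, pow_zero, Nat.factorial_zero,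
        Nat.cast_one, div_one, pow_one, norm_mul, hw1, one_mul] at this
      refine this.trans ?_
      gcongr
      exact hVu.trans (by gcongr)
    rw [hEeq, norm_mul, norm_mul]
    calc _ ≤ Real.exp ‖K‖ * (Real.exp (θ * Real.pi) * ‖1 - u‖ ^ (-(θ * w.re))) *
          (M * ‖1 - u‖ * Real.exp (M * (1 + R'))) := by gcongr
      _ = C * (‖1 - u‖ ^ (-(θ * w.re)) * ‖1 - u‖) := by
        rw [hC]
        ring
      _ = C * ‖1 - u‖ ^ (1 - θ * w.re) := by
        rw [← Real.rpow_add_one hpos.ne']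
        congr 2
        ring
  have hcoef : ∀ w n, iteratedDeriv n (E w) 0 / (n.factorial : ℂ) =
      cycleIndex (fun m => w * (m * c m)) n -
        Complex.exp (w * K) * ((∏ j ∈ Finset.range n, (θ * w + j)) / n.factorial) := by
    intro w n
    have hn : (n.factorial : ℂ) ≠ 0 := by exact_mod_cast n.factorial_ne_zero
    have hsum' : ∀ᶠ t in 𝓝 (0 : ℂ), HasSum (fun m => (w * c m) * t ^ m) (w * G t) := by
      filter_upwards [hsum] with t ht
      simpa only [mul_assoc] using ht.mul_left w
    have hexp := iteratedDeriv_exp_of_hasSum hsum' (by simp [hc]) n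
    have ha1 : ContDiffAt ℂ n (fun u => Complex.exp (w * G u)) 0 :=
      (((hG.const_mul w).cexp).analyticAt (hopen.mem_nhds h0mem)).contDiffAt
    have ha2 : ContDiffAt ℂ n
        (fun u => Complex.exp (-(θ * w) * Complex.log (1 - u))) 0 :=
      (((hlogd.const_mul _).cexp).analyticAt (hopen.mem_nhds h0mem)).contDiffAt
    rw [hE, iteratedDeriv_fun_sub ha1 (contDiffAt_const.mul ha2), hexp,
      iteratedDeriv_const_mul_field, iteratedDeriv_exp_neg_mul_log_one_sub_zero]
    simp only [mul_left_comm _ w]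
    field_simp
  rw [Metric.tendstoUniformlyOn_iff]
  intro ε hε
  have hmain := (Metric.tendstoUniformlyOn_iff.1 (tendstoUniformlyOn_invGammaSeq θ)) (ε / 2)
    (half_pos hε)
  have hsmall : Tendsto (fun n : ℕ => A * Real.exp ‖K‖ * (1 / (n : ℝ))) atTop (𝓝 0) := by
    simpa using tendsto_one_div_atTop_nhds_zero_nat.const_mul (A * Real.exp ‖K‖)
  filter_upwards [hmain, hsmall.eventually (gt_mem_nhds (half_pos hε)), eventually_ge_atTop N,
    eventually_gt_atTop 0] with n hn1 hn2 hnN hn0 w hw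
  have hw1 : ‖w‖ = 1 := mem_sphere_zero_iff_norm.1 hw
  have hnR : (0 : ℝ) < n := by exact_mod_cast hn0
  have hmem : (θ * w : ℂ) ∈ Metric.closedBall (0 : ℂ) θ := by
    rw [mem_closedBall_zero_iff, norm_mul, hw1, mul_one, Complex.norm_real,
      Real.norm_of_nonneg hθ]
  have hq : |1 - θ * w.re| ≤ 1 + θ := by
    refine (abs_sub _ _).trans ?_
    rw [abs_one, abs_mul, abs_of_nonneg hθ]
    nlinarith [(hre w hw).1]
  have herr := hA _ hq (E w) (hEd w) (hEb w hw) n hnN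
  rw [hcoef] at herr
  set P := cycleIndex (fun m => w * (m * c m)) n
  have hdiff : P * Complex.exp ((1 - θ * w) * (Real.log n : ℂ)) * Complex.exp (-(w * K)) -
      invGammaSeq n (θ * w) =
      (P - Complex.exp (w * K) * ((∏ j ∈ Finset.range n, (θ * w + j)) / n.factorial)) *
      (Complex.exp ((1 - θ * w) * (Real.log n : ℂ)) * Complex.exp (-(w * K))) := by
    have : Complex.exp (w * K) * Complex.exp (-(w * K)) = 1 := by
      rw [← Complex.exp_add]
      simp
    rw [invGammaSeq]
    linear_combination ((∏ j ∈ Finset.range n, (θ * w + j)) / n.factorial *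
      Complex.exp ((1 - θ * w) * (Real.log n : ℂ))) * this
  have hnorm1 : ‖Complex.exp ((1 - θ * w) * (Real.log n : ℂ))‖ = (n : ℝ) ^ (1 - θ * w.re) := by
    rw [Complex.norm_exp, Real.rpow_def_of_pos hnR]
    congr 1
    rw [Complex.re_mul_ofReal, mul_comm]
    simp
  have hnorm2 : ‖Complex.exp (-(w * K))‖ ≤ Real.exp ‖K‖ := by
    refine (Complex.norm_exp_le_exp_norm _).trans ?_
    rw [norm_neg, norm_mul, hw1, one_mul]
  -- The powers of `n` depending on `w` cancel and leave `1/n`, uniformly in `w`.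
  have herr2 : dist (invGammaSeq n (θ * w))
      (P * Complex.exp ((1 - θ * w) * (Real.log n : ℂ)) * Complex.exp (-(w * K))) ≤
      A * Real.exp ‖K‖ * (1 / (n : ℝ)) := by
    rw [dist_comm, dist_eq_norm, hdiff, norm_mul, norm_mul, hnorm1]
    calc _ ≤ A * (n : ℝ) ^ (-(1 - θ * w.re) - 1) *
          ((n : ℝ) ^ (1 - θ * w.re) * Real.exp ‖K‖) := by gcongr
      _ = A * Real.exp ‖K‖ * ((n : ℝ) ^ (-(1 - θ * w.re) - 1) * (n : ℝ) ^ (1 - θ * w.re)) := by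
        ring
      _ = A * Real.exp ‖K‖ * (1 / (n : ℝ)) := by
        rw [← Real.rpow_add hnR, show -(1 - θ * w.re) - 1 + (1 - θ * w.re) = -1 by ring,
          Real.rpow_neg_one, one_div]
  calc _ ≤ _ := dist_triangle _ (invGammaSeq n (θ * w)) _
    _ < ε / 2 + ε / 2 := add_lt_add_of_lt_of_le (hn1 _ hmem) (herr2.trans hn2.le)
    _ = ε := add_halves ε

/-- Cycle lengths add up to `n`; here this homogeneity is read off from the recurrence. -/
theorem cycleIndex_mul_pow (x : ℕ → ℂ) (ρ : ℂ) (n : ℕ) :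
    cycleIndex (fun m => x m * ρ ^ m) n = ρ ^ n * cycleIndex x n := by
  induction n using Nat.strong_induction_on with
  | _ n ih =>
    rcases Nat.eq_zero_or_pos n with rfl | hn
    · simp [cycleIndex_zero]
    have hn0 : (n : ℂ) ≠ 0 := by exact_mod_cast hn.ne'
    refine mul_left_cancel₀ hn0 ?_
    rw [natCast_mul_cycleIndex, mul_left_comm, natCast_mul_cycleIndex, Finset.mul_sum]
    refine Finset.sum_congr rfl fun m hm => ?_
    rw [Finset.mem_Icc] at hm
    rw [ih _ (by omega)]
    have : ρ ^ n = ρ ^ m * ρ ^ (n - m) := by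
      rw [← pow_add]
      congr 1
      omega
    rw [this]
    ring

/-- The cycle indices in the variables `w m g_m`, that is the coefficients of `exp (w g)`, for a
power series `g` of class `F(ρ, θ)`. -/
theorem tendstoUniformlyOn_cycleIndex {g : PowerSeries ℂ} {ρ θ : ℝ} {K : ℂ}
    (hg : IsClassFWith g ρ θ K) (hg0 : PowerSeries.coeff 0 g = 0) :
    TendstoUniformlyOn (fun (n : ℕ) (w : ℂ) =>
      (ρ : ℂ) ^ n * cycleIndex (fun m => w * (m * PowerSeries.coeff m g)) n *
      Complex.exp ((1 - θ * w) * (Real.log n : ℂ)) * Complex.exp (-(w * K)))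
      (fun w => (Complex.Gamma (θ * w))⁻¹) atTop (Metric.sphere 0 1) := by
  obtain ⟨hρ, hθ, R, φ, hR, h0, hπ, G, hG, hsum, hO⟩ := hg
  have hρ0 : (ρ : ℂ) ≠ 0 := by exact_mod_cast hρ.ne'
  have hmaps : ∀ t ∈ Delta0 1 (R / ρ) φ, (ρ : ℂ) * t ∈ Delta0 ρ R φ := by
    intro t ht
    rw [Delta0_eq h0 hπ] at ht ⊢
    obtain ⟨h1, h2⟩ := ht
    rw [Complex.ofReal_one] at h2
    refine ⟨?_, ?_⟩
    · rw [norm_mul, Complex.norm_real, Real.norm_of_nonneg hρ.le]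
      rwa [lt_div_iff₀' hρ] at h1
    · rw [show (ρ : ℂ) * t - ρ = ρ * (t - 1) by ring, Complex.re_ofReal_mul, norm_mul,
        Complex.norm_real, Real.norm_of_nonneg hρ.le]
      nlinarith
  have hcont : Continuous fun t : ℂ => (ρ : ℂ) * t := by fun_prop
  -- The substitution `t ↦ ρ t` moves the singularity to `1`.
  have key := tendstoUniformlyOn_cycleIndex_one (G := fun t => G (ρ * t)) (K := K)
    (c := fun m => PowerSeries.coeff m g * (ρ : ℂ) ^ m) (R := R / ρ) ((one_lt_div hρ).2 hR) h0 hπ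
    hθ (hG.comp (by fun_prop) hmaps) ?_ (by simp [hg0]) ?_
  · refine key.congr (Eventually.of_forall fun n w _ => ?_)
    simp only [← cycleIndex_mul_pow]
    congr 4
    ext m
    ring
  · have ht : Tendsto (fun t : ℂ => (ρ : ℂ) * t) (𝓝 0) (𝓝 0) := by
      simpa using hcont.tendsto 0
    filter_upwards [ht.eventually hsum] with t ht
    simpa only [mul_pow, mul_assoc] using ht
  · have ht : Tendsto (fun t : ℂ => (ρ : ℂ) * t) (𝓝[Delta0 1 (R / ρ) φ] 1) (𝓝[Delta0 ρ R φ] ρ) := by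
      refine tendsto_nhdsWithin_of_tendsto_nhds_of_eventually_within _ ?_ ?_
      · simpa using (hcont.tendsto 1).mono_left nhdsWithin_le_nhds
      · filter_upwards [self_mem_nhdsWithin] with t ht using hmaps t ht
    have h1 := hO.comp_tendsto ht
    refine (h1.congr_left fun t => ?_).trans ?_
    · simp only [Function.comp_apply]
      rw [mul_div_cancel_left₀ _ hρ0]
    · refine (isBigO_const_mul_self (ρ : ℂ) (fun t : ℂ => t - 1) _).congr_left fun t => ?_
      simp only [Function.comp_apply]
      ring

/-! ### Power series of class `F(r, θ)` with real coefficients -/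

theorem ball_subset_Delta0 {r R φ : ℝ} (hR : r < R) (h0 : 0 < φ) (hπ : φ < Real.pi / 2) :
    Metric.ball (0 : ℂ) r ⊆ Delta0 r R φ := by
  intro z hz
  rw [mem_ball_zero_iff] at hz
  rw [Delta0_eq h0 hπ]
  have hcos : 0 < Real.cos φ := Real.cos_pos_of_mem_Ioo ⟨by linarith, hπ⟩
  refine ⟨hz.trans hR, ?_⟩
  have h1 := Complex.re_le_norm z
  have h2 : 0 ≤ Real.cos φ * ‖z - r‖ := by positivity
  simp only [Complex.sub_re, Complex.ofReal_re]
  linarith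

/-- An expansion known only near `0` is the Taylor series, which converges on every disc of
holomorphy. -/
theorem hasSum_of_differentiableOn_ball {c : ℕ → ℂ} {f : ℂ → ℂ} {r : ℝ}
    (hf : DifferentiableOn ℂ f (Metric.ball 0 r))
    (h : ∀ᶠ t in 𝓝 (0 : ℂ), HasSum (fun m => c m * t ^ m) (f t)) {t : ℂ}
    (ht : t ∈ Metric.ball (0 : ℂ) r) : HasSum (fun m => c m * t ^ m) (f t) := by
  refine (Complex.hasSum_taylorSeries_on_ball hf ht).congr_fun fun m => ?_
  have hm : (m.factorial : ℂ) ≠ 0 := by exact_mod_cast m.factorial_ne_zero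
  rw [iteratedDeriv_of_hasSum h, sub_zero, smul_eq_mul, smul_eq_mul]
  field_simp

/-- On `(0, r)` both `G` and the logarithm are real, so the error term has constant imaginary part
`-Im K`; it tends to `0` at `r`. -/
theorem IsClassFWith.im_eq_zero {g : PowerSeries ℂ} {r θ : ℝ} {K : ℂ} (hg : IsClassFWith g r θ K)
    (hreal : ∀ m, (PowerSeries.coeff m g).im = 0) : K.im = 0 := by
  obtain ⟨hr, -, R, φ, hR, h0, hπ, G, hG, hsum, hO⟩ := hg
  have hball := ball_subset_Delta0 hR h0 hπ
  have hmem : ∀ x ∈ Set.Ioo 0 r, (x : ℂ) ∈ Metric.ball (0 : ℂ) r := fun x hx => by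
    rw [mem_ball_zero_iff, Complex.norm_real, Real.norm_of_nonneg hx.1.le]
    exact hx.2
  have hev : ∀ᶠ x in 𝓝[<] r, x ∈ Set.Ioo 0 r := Ioo_mem_nhdsLT hr
  have ht : Tendsto (fun x : ℝ => (x : ℂ)) (𝓝[<] r) (𝓝[Delta0 r R φ] r) := by
    refine tendsto_nhdsWithin_of_tendsto_nhds_of_eventually_within _ ?_ ?_
    · exact (Complex.continuous_ofReal.tendsto r).mono_left nhdsWithin_le_nhds
    · filter_upwards [hev] with x hx using hball (hmem x hx)
  have hzero : Tendsto (fun t : ℂ => t - (r : ℂ)) (𝓝[Delta0 r R φ] (r : ℂ)) (𝓝 0) := by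
    have : Continuous fun t : ℂ => t - (r : ℂ) := by fun_prop
    simpa using (this.tendsto (r : ℂ)).mono_left nhdsWithin_le_nhds
  have h1 := (Complex.continuous_im.tendsto 0).comp ((hO.trans_tendsto hzero).comp ht)
  have h2 : Tendsto (fun _ : ℝ => -K.im) (𝓝[<] r) (𝓝 0) := by
    refine h1.congr' ?_
    filter_upwards [hev] with x hx
    have hx1 : x / r < 1 := (div_lt_one hr).2 hx.2
    have hGx : (G x).im = 0 := by
      have := hasSum_of_differentiableOn_ball (hG.mono hball) hsum (hmem x hx)
      refine (Complex.hasSum_im this).unique ?_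
      convert hasSum_zero with m
      rw [← Complex.ofReal_pow, Complex.im_mul_ofReal, hreal, zero_mul]
    have hlog : Complex.log (1 / (1 - (x : ℂ) / r)) = (Real.log (1 / (1 - x / r)) : ℂ) := by
      rw [Complex.ofReal_log (by
        have : 0 < 1 - x / r := by linarith
        positivity)]
      push_cast
      rfl
    simp only [Function.comp_apply]
    rw [hlog, ← Complex.ofReal_mul, Complex.sub_im, Complex.add_im, Complex.ofReal_im, hGx]
    ring
  simpa using tendsto_nhds_unique h2 tendsto_const_nhds

/-! ### The numbers `e^{-ε(k)}` -/

variable {d : ℕ}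

theorem expNegEps_eq_integral {ξ : EuclideanSpace ℝ (Fin d) → ℝ} (hc : Continuous ξ)
    (hi : Integrable fun x => Real.exp (-ξ x)) (k : EuclideanSpace ℝ (Fin d)) :
    Integrable (fun x => Real.exp (-ξ x) * Real.cos (2 * Real.pi * inner ℝ k x)) ∧
    expNegEps ξ k = ∫ x, Real.exp (-ξ x) * Real.cos (2 * Real.pi * inner ℝ k x) := by
  have hint : Integrable fun x : EuclideanSpace ℝ (Fin d) => Complex.exp (-(ξ x : ℂ)) *
      Complex.exp (-(2 * Real.pi * Complex.I * (inner ℝ k x : ℝ))) := by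
    refine hi.mono' (Continuous.aestronglyMeasurable (by fun_prop)) (Eventually.of_forall fun x => ?_)
    rw [norm_mul, Complex.norm_exp, Complex.norm_exp]
    simp
  have hre : ∀ x : EuclideanSpace ℝ (Fin d), (Complex.exp (-(ξ x : ℂ)) *
      Complex.exp (-(2 * Real.pi * Complex.I * (inner ℝ k x : ℝ)))).re =
      Real.exp (-ξ x) * Real.cos (2 * Real.pi * inner ℝ k x) := by
    intro x
    rw [← Complex.ofReal_neg, ← Complex.ofReal_exp, Complex.re_ofReal_mul,
      show -(2 * Real.pi * Complex.I * ((inner ℝ k x : ℝ) : ℂ)) =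
        ((-(2 * Real.pi * inner ℝ k x) : ℝ) : ℂ) * Complex.I by push_cast; ring,
      Complex.exp_ofReal_mul_I_re, Real.cos_neg]
  have h1 := hint.re
  have h2 := integral_re hint
  simp only [RCLike.re_eq_complex_re, hre] at h1 h2
  exact ⟨h1, h2.symm⟩

theorem expNegEps_zero_pos {ξ : EuclideanSpace ℝ (Fin d) → ℝ} (hc : Continuous ξ)
    (hi : Integrable fun x => Real.exp (-ξ x)) : 0 < expNegEps ξ 0 := by
  rw [(expNegEps_eq_integral hc hi 0).2]
  simp only [inner_zero_left, mul_zero, Real.cos_zero, mul_one]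
  exact integral_exp_pos hi

/-- The difference is the integral of the continuous nonnegative function `e^{-ξ} (1 - cos (2π⟨k,
x⟩))`, positive at `x = k / (2‖k‖²)`, where `⟨k, x⟩ = 1/2`. -/
theorem expNegEps_lt {ξ : EuclideanSpace ℝ (Fin d) → ℝ} (hc : Continuous ξ)
    (hi : Integrable fun x => Real.exp (-ξ x)) {k : EuclideanSpace ℝ (Fin d)} (hk : k ≠ 0) :
    expNegEps ξ k < expNegEps ξ 0 := by
  obtain ⟨hi0, h0⟩ := expNegEps_eq_integral hc hi 0
  obtain ⟨hik, hk'⟩ := expNegEps_eq_integral hc hi k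
  rw [← sub_pos, h0, hk', ← integral_sub hi0 hik]
  have hnn : 0 ≤ fun x => Real.exp (-ξ x) * Real.cos (2 * Real.pi * inner ℝ 0 x) -
      Real.exp (-ξ x) * Real.cos (2 * Real.pi * inner ℝ k x) := by
    intro x
    simp only [inner_zero_left, mul_zero, Real.cos_zero, mul_one, Pi.zero_apply]
    nlinarith [Real.exp_pos (-ξ x), Real.cos_le_one (2 * Real.pi * inner ℝ k x)]
  rw [integral_pos_iff_support_of_nonneg hnn (hi0.sub hik)]
  refine IsOpen.measure_pos _ (Continuous.isOpen_support (by fun_prop)) ⟨(2 * ‖k‖ ^ 2)⁻¹ • k, ?_⟩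
  have hk2 : ‖k‖ ^ 2 ≠ 0 := by simpa using hk
  have harg : 2 * Real.pi * inner ℝ k ((2 * ‖k‖ ^ 2)⁻¹ • k) = Real.pi := by
    rw [inner_smul_right, real_inner_self_eq_norm_sq]
    field_simp
  rw [Function.mem_support, harg, Real.cos_pi]
  simp only [inner_zero_left, mul_zero, Real.cos_zero, mul_one]
  have := Real.exp_pos (-ξ ((2 * ‖k‖ ^ 2)⁻¹ • k))
  linarith

section Lattice

variable {ξ : EuclideanSpace ℝ (Fin d) → ℝ} {Λ : Submodule ℤ (EuclideanSpace ℝ (Fin d))}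

theorem rTilde_eq (hξ : IsAdmissible ξ Λ) : rTilde ξ Λ = (expNegEps ξ 0)⁻¹ := by
  have h0 := expNegEps_zero_pos hξ.continuous hξ.integrable
  refine IsLeast.csInf_eq ⟨⟨0, Λ.zero_mem, h0, rfl⟩, ?_⟩
  rintro x ⟨k, -, hpos, rfl⟩
  refine inv_anti₀ hpos ?_
  rcases eq_or_ne k 0 with rfl | hk
  · exact le_rfl
  · exact (expNegEps_lt hξ.continuous hξ.integrable hk).le

/-- The strict maximum at `k = 0` is attained nowhere else. Hence the limiting function involves `α`
where `A α` might be expected. -/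
theorem minCount_eq_one (hξ : IsAdmissible ξ Λ) : minCount ξ Λ = 1 := by
  have h0 := expNegEps_zero_pos hξ.continuous hξ.integrable
  rw [minCount, Set.ncard_eq_one]
  refine ⟨0, Set.eq_singleton_iff_unique_mem.2 ⟨⟨Λ.zero_mem, h0, (rTilde_eq hξ).symm⟩, ?_⟩⟩
  rintro k ⟨-, -, hk⟩
  by_contra hne
  rw [rTilde_eq hξ, inv_inj] at hk
  exact (expNegEps_lt hξ.continuous hξ.integrable hne).ne hk

/-- Summability puts all but finitely many values below half the maximum; the finitely many others
with `k ≠ 0` are each strictly below it. -/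
theorem exists_gap (hξ : IsAdmissible ξ Λ) :
    ∃ q : ℝ, 0 < q ∧ q < expNegEps ξ 0 ∧ ∀ k : Λ, k ≠ 0 → expNegEps ξ k ≤ q := by
  have h0 := expNegEps_zero_pos hξ.continuous hξ.integrable
  have hfin : {k : Λ | ¬ expNegEps ξ k < expNegEps ξ 0 / 2}.Finite :=
    hξ.summable.tendsto_cofinite_zero.eventually (gt_mem_nhds (half_pos h0))
  have h1 : ∀ᶠ q in 𝓝[<] (expNegEps ξ 0), ∀ k ∈ {k : Λ | ¬ expNegEps ξ k < expNegEps ξ 0 / 2},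
      k ≠ 0 → expNegEps ξ k ≤ q := by
    refine (eventually_all_finite hfin).2 fun k _ => ?_
    by_cases hk : k = 0
    · exact Eventually.of_forall fun q h => absurd hk h
    · have hlt := expNegEps_lt hξ.continuous hξ.integrable (k := (k : EuclideanSpace ℝ (Fin d)))
        (by simpa using hk)
      filter_upwards [Ioo_mem_nhdsLT hlt] with q hq _ using hq.1.le
  obtain ⟨q, hq1, hq2⟩ := (h1.and (Ioo_mem_nhdsLT (half_lt_self h0))).exists
  refine ⟨q, (half_pos h0).trans hq2.1, hq2.2, fun k hk => ?_⟩
  by_cases hk2 : expNegEps ξ k < expNegEps ξ 0 / 2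
  · exact hk2.le.trans hq2.1.le
  · exact hq1 k hk2 hk

theorem expNegEps_le_zero (hξ : IsAdmissible ξ Λ) (k : EuclideanSpace ℝ (Fin d)) :
    expNegEps ξ k ≤ expNegEps ξ 0 := by
  rcases eq_or_ne k 0 with rfl | hk
  · exact le_rfl
  · exact (expNegEps_lt hξ.continuous hξ.integrable hk).le

theorem summable_expNegEps_pow (hξ : IsAdmissible ξ Λ) {m : ℕ} (hm : m ≠ 0) :
    Summable fun k : Λ => expNegEps ξ k ^ m := by
  obtain ⟨j, rfl⟩ := Nat.exists_eq_succ_of_ne_zero hm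
  refine Summable.of_nonneg_of_le (fun k => pow_nonneg (hξ.nonneg k k.2) _) (fun k => ?_)
    (hξ.summable.mul_left (expNegEps ξ 0 ^ j))
  rw [pow_succ]
  have := hξ.nonneg k k.2
  gcongr
  exact expNegEps_le_zero hξ k

theorem tsum_expNegEps_pow_pos (hξ : IsAdmissible ξ Λ) {m : ℕ} (hm : m ≠ 0) :
    0 < ∑' k : Λ, expNegEps ξ k ^ m :=
  (summable_expNegEps_pow hξ hm).tsum_pos (fun k => pow_nonneg (hξ.nonneg k k.2) _) 0
    (pow_pos (by simpa using expNegEps_zero_pos hξ.continuous hξ.integrable) _)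

/-- Bound all but one factor of each power by `q`: the power sums over `k ≠ 0` decay like `q ^ m`.
-/
theorem tsum_ite_expNegEps_pow_le (hξ : IsAdmissible ξ Λ) {q : ℝ} (hq0 : 0 < q)
    (hq : ∀ k : Λ, k ≠ 0 → expNegEps ξ k ≤ q) {m : ℕ} (hm : m ≠ 0) :
    0 ≤ (∑' k : Λ, if k = 0 then 0 else expNegEps ξ k ^ m) ∧
    (∑' k : Λ, if k = 0 then 0 else expNegEps ξ k ^ m) ≤
      (∑' k : Λ, expNegEps ξ k) / q * q ^ m := by
  obtain ⟨j, rfl⟩ := Nat.exists_eq_succ_of_ne_zero hm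
  have hnn : ∀ k : Λ, 0 ≤ if k = 0 then 0 else expNegEps ξ k ^ (j + 1) := fun k => by
    split_ifs
    · exact le_rfl
    · exact pow_nonneg (hξ.nonneg k k.2) _
  have hle : ∀ k : Λ, (if k = 0 then 0 else expNegEps ξ k ^ (j + 1)) ≤ q ^ j * expNegEps ξ k := by
    intro k
    have := hξ.nonneg k k.2
    split_ifs with hk
    · positivity
    · rw [pow_succ]
      gcongr
      exact hq k hk
  have hs := hξ.summable.mul_left (q ^ j)
  refine ⟨tsum_nonneg hnn, ?_⟩
  refine ((Summable.of_nonneg_of_le hnn hle hs).tsum_le_tsum hle hs).trans_eq ?_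
  rw [tsum_mul_left, Nat.succ_eq_add_one, pow_succ]
  field_simp

/-! ### The class of `g^{(α,ξ)}` -/

theorem coeff_gAlphaXi (hξ : IsAdmissible ξ Λ) (a : ℕ → ℝ) (m : ℕ) :
    PowerSeries.coeff m (gAlphaXi a ξ Λ) =
      PowerSeries.coeff m (gAlpha a) * (expNegEps ξ 0 : ℂ) ^ m +
      PowerSeries.coeff m (gAlpha a) *
        ((∑' k : Λ, if k = 0 then 0 else expNegEps ξ k ^ m : ℝ) : ℂ) := by
  rw [gAlphaXi, gAlpha, PowerSeries.coeff_mk, PowerSeries.coeff_mk]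
  split_ifs with hm
  · simp
  · rw [tsum_mul_left, (summable_expNegEps_pow hξ hm).tsum_eq_add_tsum_ite 0]
    push_cast
    ring

/-- The term `k = 0` is `G (e t)`, singular at `ρ = r / e`. The rest, `H`, is holomorphic near `ρ`,
so it contributes `H(ρ) + O(t - ρ)`, and the new constant is `K + H(ρ)`. -/
theorem exists_isClassFWith_gAlphaXi (hξ : IsAdmissible ξ Λ) {a : ℕ → ℝ} {r θ : ℝ}
    (hg : IsClassF (gAlpha a) r θ) :
    ∃ K : ℝ, IsClassFWith (gAlphaXi a ξ Λ) ((expNegEps ξ 0)⁻¹ * r) θ K := by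
  suffices h : ∃ K : ℂ, IsClassFWith (gAlphaXi a ξ Λ) ((expNegEps ξ 0)⁻¹ * r) θ K by
    obtain ⟨K, hK⟩ := h
    refine ⟨K.re, ?_⟩
    have him := hK.im_eq_zero fun m => by
      rw [gAlphaXi, PowerSeries.coeff_mk]
      split_ifs
      · simp
      · exact Complex.ofReal_im _
    rwa [show ((K.re : ℝ) : ℂ) = K from Complex.ext (by simp) (by simp [him])]
  obtain ⟨K, hr, hθ, R, φ, hR, h0, hπ, G, hG, hsum, hO⟩ := hg
  set e := expNegEps ξ 0 with he
  have he0 : 0 < e := expNegEps_zero_pos hξ.continuous hξ.integrable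
  have hec : (e : ℂ) ≠ 0 := by exact_mod_cast he0.ne'
  have hrc : (r : ℂ) ≠ 0 := by exact_mod_cast hr.ne'
  obtain ⟨q, hq0, hqe, hq⟩ := exists_gap hξ
  set S := ∑' k : Λ, expNegEps ξ k
  set c : ℕ → ℂ := fun m => PowerSeries.coeff m (gAlpha a) with hc
  set s : ℕ → ℝ := fun m => ∑' k : Λ, if k = 0 then 0 else expNegEps ξ k ^ m with hs
  have hc0 : c 0 = 0 := by simp [hc, gAlpha]
  have hS0 : 0 ≤ S := tsum_nonneg fun k => hξ.nonneg k k.2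
  -- With `q₂` strictly between `q` and `e`, the radius `R₁ = r / q₂` exceeds `r / e`, while `q * R₁
  -- < r` makes the majorant of `H` converge.
  set q₂ := (q + e) / 2 with hq₂
  have hq₂0 : 0 < q₂ := by linarith
  set R₁ := r / q₂ with hR₁
  have hR₁0 : 0 < R₁ := by positivity
  have hqR₁ : q * R₁ < r := by
    rw [hR₁, mul_div_assoc', div_lt_iff₀ hq₂0]
    nlinarith
  have hρR₁ : e⁻¹ * r < R₁ := by
    rw [hR₁, inv_mul_eq_div]
    exact div_lt_div_of_pos_left hr hq₂0 (by linarith)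
  have hsumm : Summable fun m => S / q * (‖c m‖ * (q * R₁) ^ m) := by
    have hmem : ((q * R₁ : ℝ) : ℂ) ∈ Metric.ball (0 : ℂ) r := by
      rw [mem_ball_zero_iff, Complex.norm_real, Real.norm_of_nonneg (by positivity)]
      exact hqR₁
    have := (hasSum_of_differentiableOn_ball (hG.mono (ball_subset_Delta0 hR h0 hπ)) hsum
      hmem).summable.norm
    refine Summable.mul_left _ (this.congr fun m => ?_)
    rw [norm_mul, norm_pow, Complex.norm_real, Real.norm_of_nonneg (by positivity)]
  have hterm : ∀ m, ∀ t ∈ Metric.ball (0 : ℂ) R₁,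
      ‖c m * (s m : ℂ) * t ^ m‖ ≤ S / q * (‖c m‖ * (q * R₁) ^ m) := by
    intro m t ht
    rcases eq_or_ne m 0 with rfl | hm
    · simp [hc0]
    obtain ⟨h1, h2⟩ := tsum_ite_expNegEps_pow_le hξ hq0 hq hm
    rw [norm_mul, norm_mul, norm_pow, Complex.norm_real, Real.norm_of_nonneg h1]
    rw [mem_ball_zero_iff] at ht
    calc ‖c m‖ * s m * ‖t‖ ^ m ≤ ‖c m‖ * (S / q * q ^ m) * R₁ ^ m := by gcongr
      _ = S / q * (‖c m‖ * (q * R₁) ^ m) := by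
        rw [mul_pow]
        ring
  set H : ℂ → ℂ := fun t => ∑' m, c m * (s m : ℂ) * t ^ m with hH
  have hHd : DifferentiableOn ℂ H (Metric.ball 0 R₁) :=
    Complex.differentiableOn_tsum_of_summable_norm hsumm (fun m => by fun_prop) Metric.isOpen_ball hterm
  have hHsum : ∀ t ∈ Metric.ball (0 : ℂ) R₁,
      HasSum (fun m => c m * (s m : ℂ) * t ^ m) (H t) := fun t ht =>
    (Summable.of_norm_bounded hsumm fun m => hterm m t ht).hasSum
  have hmaps : ∀ t ∈ Delta0 (e⁻¹ * r) (min (R / e) R₁) φ, (e : ℂ) * t ∈ Delta0 r R φ := by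
    intro t ht
    rw [Delta0_eq h0 hπ] at ht ⊢
    obtain ⟨h1, h2⟩ := ht
    have h3 : (e : ℂ) * t - r = e * (t - ((e⁻¹ * r : ℝ) : ℂ)) := by
      push_cast
      field_simp
    refine ⟨?_, ?_⟩
    · rw [norm_mul, Complex.norm_real, Real.norm_of_nonneg he0.le, ← lt_div_iff₀' he0]
      exact h1.trans_le (min_le_left _ _)
    · rw [h3, Complex.re_ofReal_mul, norm_mul, Complex.norm_real, Real.norm_of_nonneg he0.le]
      nlinarith
  have hcont : Continuous fun t : ℂ => (e : ℂ) * t := by fun_prop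
  have hρ0 : 0 < e⁻¹ * r := by positivity
  refine ⟨K + H ((e⁻¹ * r : ℝ) : ℂ), hρ0, hθ, min (R / e) R₁, φ, lt_min ?_ hρR₁, h0, hπ,
    fun t => G (e * t) + H t, ?_, ?_, ?_⟩
  · rw [inv_mul_eq_div]
    gcongr
  · refine (hG.comp (by fun_prop) hmaps).add (hHd.mono fun t ht => ?_)
    rw [mem_ball_zero_iff]
    exact ht.1.trans_le (min_le_right _ _)
  · have ht : Tendsto (fun t : ℂ => (e : ℂ) * t) (𝓝 0) (𝓝 0) := by
      simpa using hcont.tendsto 0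
    filter_upwards [ht.eventually hsum, Metric.ball_mem_nhds 0 hR₁0] with t ht1 ht2
    refine (ht1.add (hHsum t ht2)).congr_fun fun m => ?_
    rw [coeff_gAlphaXi hξ, mul_pow]
    ring
  · have ht : Tendsto (fun t : ℂ => (e : ℂ) * t)
        (𝓝[Delta0 (e⁻¹ * r) (min (R / e) R₁) φ] ((e⁻¹ * r : ℝ) : ℂ)) (𝓝[Delta0 r R φ] r) := by
      refine tendsto_nhdsWithin_of_tendsto_nhds_of_eventually_within _ ?_ ?_
      · have := hcont.tendsto ((e⁻¹ * r : ℝ) : ℂ)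
        rw [show (e : ℂ) * ((e⁻¹ * r : ℝ) : ℂ) = r by push_cast; field_simp] at this
        exact this.mono_left nhdsWithin_le_nhds
      · filter_upwards [self_mem_nhdsWithin] with t ht using hmaps t ht
    have hmemρ : ((e⁻¹ * r : ℝ) : ℂ) ∈ Metric.ball (0 : ℂ) R₁ := by
      rw [mem_ball_zero_iff, Complex.norm_real, Real.norm_of_nonneg hρ0.le]
      exact hρR₁
    have h1 : (fun t : ℂ => G (e * t) - (θ * Complex.log (1 / (1 - (e * t) / r)) + K))
        =O[𝓝[Delta0 (e⁻¹ * r) (min (R / e) R₁) φ] ((e⁻¹ * r : ℝ) : ℂ)]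
        fun t => t - ((e⁻¹ * r : ℝ) : ℂ) := by
      refine (hO.comp_tendsto ht).trans ?_
      refine (isBigO_const_mul_self (e : ℂ) (fun t : ℂ => t - ((e⁻¹ * r : ℝ) : ℂ)) _).congr_left
        fun t => ?_
      simp only [Function.comp_apply]
      push_cast
      field_simp
    have h2 := ((hHd.differentiableAt (Metric.isOpen_ball.mem_nhds hmemρ)).isBigO_sub).mono
      (nhdsWithin_le_nhds (s := Delta0 (e⁻¹ * r) (min (R / e) R₁) φ))
    refine (h1.add h2).congr_left fun t => ?_
    have h3 : t / ((e⁻¹ * r : ℝ) : ℂ) = e * t / r := by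
      push_cast
      field_simp
    rw [h3]
    ring

end Lattice

/-! ### The spatial measure -/

theorem isProbabilityMeasure_weightedMeasure {F : ℕ → ℕ → ℝ} {n : ℕ}
    (hF : ∀ σ : Equiv.Perm (Fin n), 0 < permWeight F σ) :
    0 < normConst F n ∧ IsProbabilityMeasure (weightedMeasure F n) := by
  have hsum : 0 < ∑ σ : Equiv.Perm (Fin n), permWeight F σ :=
    Finset.sum_pos (fun σ _ => hF σ) Finset.univ_nonempty
  have hn : (0 : ℝ) < n.factorial := by exact_mod_cast n.factorial_pos
  have hpos : 0 < normConst F n := mul_pos (by positivity) hsum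
  refine ⟨hpos, ⟨?_⟩⟩
  have hterm : ∀ σ ∈ (Finset.univ : Finset (Equiv.Perm (Fin n))),
      0 ≤ 1 / ((n.factorial : ℝ) * normConst F n) * permWeight F σ := fun σ _ =>
    mul_nonneg (by positivity) (hF σ).le
  simp only [weightedMeasure, Measure.coe_finsetSum, Finset.sum_apply, Measure.smul_apply,
    measure_univ, smul_eq_mul, mul_one]
  rw [← ENNReal.ofReal_sum_of_nonneg hterm, ← Finset.mul_sum, ENNReal.ofReal_eq_one,
    show ∑ σ : Equiv.Perm (Fin n), permWeight F σ = n.factorial * normConst F n by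
      rw [normConst]
      field_simp]
  field_simp

theorem integral_weightedMeasure {F : ℕ → ℕ → ℝ} {n : ℕ}
    (hF : ∀ σ : Equiv.Perm (Fin n), 0 < permWeight F σ) (f : Equiv.Perm (Fin n) → ℂ) :
    ∫ σ, f σ ∂(weightedMeasure F n) = (1 / ((n.factorial : ℂ) * normConst F n)) *
      ∑ σ : Equiv.Perm (Fin n), (permWeight F σ : ℂ) * f σ := by
  have hpos := (isProbabilityMeasure_weightedMeasure hF).1
  rw [weightedMeasure, integral_finsetSum_measure fun σ _ =>
    (integrable_dirac (by simp)).smul_measure ENNReal.ofReal_ne_top, Finset.mul_sum]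
  refine Finset.sum_congr rfl fun σ _ => ?_
  have := (hF σ).le
  rw [integral_smul_measure, integral_dirac, ENNReal.toReal_ofReal (by positivity),
    Complex.real_smul]
  push_cast
  ring

theorem cycleIndex_congr {x y : ℕ → ℂ} (h : ∀ m, m ≠ 0 → x m = y m) (n : ℕ) :
    cycleIndex x n = cycleIndex y n := by
  rw [cycleIndex, cycleIndex]
  congr 1
  refine Finset.sum_congr rfl fun σ _ => Finset.prod_congr rfl fun m hm => ?_
  rw [h m (by have := (Finset.mem_Icc.1 hm).1; omega)]

variable {ξ : EuclideanSpace ℝ (Fin d) → ℝ} {Λ : Submodule ℤ (EuclideanSpace ℝ (Fin d))}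

theorem permWeight_spatialF_pos (hξ : IsAdmissible ξ Λ) (a : ℕ → ℝ) {n : ℕ}
    (σ : Equiv.Perm (Fin n)) : 0 < permWeight (spatialF a ξ Λ) σ := by
  refine Finset.prod_pos fun m hm => pow_pos (mul_pos (Real.exp_pos _) ?_) _
  exact tsum_expNegEps_pow_pos hξ (by have := (Finset.mem_Icc.1 hm).1; omega)

theorem mul_coeff_gAlphaXi (a : ℕ → ℝ) {m : ℕ} (hm : m ≠ 0) :
    (m : ℂ) * PowerSeries.coeff m (gAlphaXi a ξ Λ) =
      ((Real.exp (-a m) * ∑' k : Λ, expNegEps ξ k ^ m : ℝ) : ℂ) := by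
  have : (m : ℂ) ≠ 0 := by exact_mod_cast hm
  rw [gAlphaXi, PowerSeries.coeff_mk, if_neg hm, tsum_mul_left]
  push_cast
  field_simp

/-- The characteristic function of the number of cycles is a quotient of coefficients of
`exp (w g)`. -/
theorem charFun_totalCycles (hξ : IsAdmissible ξ Λ) (a : ℕ → ℝ) (n : ℕ) (s : ℝ) :
    ∫ σ, Complex.exp (Complex.I * s * ((totalCycles n σ : ℝ) : ℂ)) ∂(spatialMeasure a ξ Λ n) =
      cycleIndex (fun m => Complex.exp (Complex.I * s) *
        (m * PowerSeries.coeff m (gAlphaXi a ξ Λ))) n /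
      cycleIndex (fun m => 1 * (m * PowerSeries.coeff m (gAlphaXi a ξ Λ))) n := by
  have hw : ∀ w : ℂ, cycleIndex (fun m => w * (m * PowerSeries.coeff m (gAlphaXi a ξ Λ))) n =
      cycleIndex (fun m => w * ((Real.exp (-a m) * ∑' k : Λ, expNegEps ξ k ^ m : ℝ) : ℂ)) n :=
    fun w => cycleIndex_congr (fun m hm => by rw [mul_coeff_gAlphaXi a hm]) n
  have hone : cycleIndex (fun m => 1 *
      ((Real.exp (-a m) * ∑' k : Λ, expNegEps ξ k ^ m : ℝ) : ℂ)) n =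
      normConst (spatialF a ξ Λ) n := by
    simp only [cycleIndex, normConst, permWeight, spatialF, one_mul, Complex.ofReal_mul,
      Complex.ofReal_sum, Complex.ofReal_prod, Complex.ofReal_pow, Complex.ofReal_div,
      Complex.ofReal_one, Complex.ofReal_natCast]
  rw [spatialMeasure, integral_weightedMeasure (permWeight_spatialF_pos hξ a), hw, hw, hone,
    cycleIndex]
  -- The factor `w ^ K_{0n}` splits over cycle lengths, so each variable absorbs one `w`.
  have hterm : ∀ σ : Equiv.Perm (Fin n), (permWeight (spatialF a ξ Λ) σ : ℂ) *
      Complex.exp (Complex.I * s * ((totalCycles n σ : ℝ) : ℂ)) =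
      ∏ m ∈ Finset.Icc 1 n, (Complex.exp (Complex.I * s) *
        ((Real.exp (-a m) * ∑' k : Λ, expNegEps ξ k ^ m : ℝ) : ℂ)) ^ cycleCount m σ := by
    intro σ
    have h1 : Complex.exp (Complex.I * s * ((totalCycles n σ : ℝ) : ℂ)) =
        ∏ m ∈ Finset.Icc 1 n, Complex.exp (Complex.I * s) ^ cycleCount m σ := by
      rw [Finset.prod_pow_eq_pow_sum, ← Complex.exp_nat_mul, totalCycles, Complex.ofReal_natCast,
        mul_comm]
    rw [h1, permWeight, Complex.ofReal_prod, ← Finset.prod_mul_distrib]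
    refine Finset.prod_congr rfl fun m _ => ?_
    rw [spatialF, Complex.ofReal_pow, mul_pow, mul_comm]
  rw [Finset.sum_congr rfl fun σ _ => hterm σ]
  simp only [div_eq_mul_inv, one_mul, mul_inv]
  ring

/-- Mod-Poisson convergence with the constant `K` absorbed into the parameters. -/
theorem strongModPoisson_totalCycles (hξ : IsAdmissible ξ Λ) (a : ℕ → ℝ) {ρ θ K : ℝ}
    (hθ : 0 < θ) (hg : IsClassFWith (gAlphaXi a ξ Λ) ρ θ K) :
    StrongModPoisson (fun n => spatialMeasure a ξ Λ n)
      (fun n σ => (totalCycles n σ : ℝ)) (fun n => K + θ * Real.log n)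
      (fun s => Complex.Gamma θ / Complex.Gamma (θ * Complex.exp (Complex.I * s))) := by
  have hmem : ∀ s : ℝ, Complex.exp (Complex.I * s) ∈ Metric.sphere (0 : ℂ) 1 := fun s => by
    rw [mem_sphere_zero_iff_norm, mul_comm, Complex.norm_exp_ofReal_mul_I]
  have hΓ : Complex.Gamma θ ≠ 0 := by
    rw [Complex.Gamma_ofReal]
    exact_mod_cast (Real.Gamma_pos_of_pos hθ).ne'
  have hρ : (ρ : ℂ) ≠ 0 := by exact_mod_cast hg.1.ne'
  have hcontΓ : Continuous fun s : ℝ => (Complex.Gamma (θ * Complex.exp (Complex.I * s)))⁻¹ :=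
    Complex.differentiable_one_div_Gamma.continuous.comp (by fun_prop)
  have hΨ : ∀ s : ℝ, Complex.Gamma θ / Complex.Gamma (θ * Complex.exp (Complex.I * s)) =
      (Complex.Gamma (θ * Complex.exp (Complex.I * s)))⁻¹ * Complex.Gamma θ := fun s => by
    rw [div_eq_mul_inv, mul_comm]
  refine ⟨fun n => (isProbabilityMeasure_weightedMeasure (permWeight_spatialF_pos hξ a)).2,
    fun n => measurable_from_top, ?_, ?_, ?_⟩
  · simp only [hΨ]
    exact hcontΓ.mul continuous_const
  · simp [hΓ]
  have hunif := tendstoUniformlyOn_cycleIndex hg (by simp [gAlphaXi])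
  set Φ : ℕ → ℂ → ℂ := fun n w =>
    (ρ : ℂ) ^ n * cycleIndex (fun m => w * (m * PowerSeries.coeff m (gAlphaXi a ξ Λ))) n *
      Complex.exp ((1 - θ * w) * (Real.log n : ℂ)) * Complex.exp (-(w * K)) with hΦ
  have h1 : TendstoLocallyUniformly (fun n (s : ℝ) => Φ n (Complex.exp (Complex.I * s)))
      (fun s : ℝ => (Complex.Gamma (θ * Complex.exp (Complex.I * s)))⁻¹) atTop := by
    refine TendstoUniformly.tendstoLocallyUniformly ?_
    rw [← tendstoUniformlyOn_univ]
    exact (hunif.comp fun s : ℝ => Complex.exp (Complex.I * s)).mono fun s _ => hmem s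
  -- Inverting the limit at `w = 1` is legitimate because `1/Γ(θ) ≠ 0` for `θ > 0`.
  have h2 : Tendsto (fun n => (Φ n 1)⁻¹) atTop (𝓝 (Complex.Gamma θ)) := by
    have := (hunif.tendsto_at (x := 1) (by simp)).inv₀ (by simpa using hΓ)
    simpa using this
  have h3 : TendstoLocallyUniformly (fun n (_ : ℝ) => (Φ n 1)⁻¹)
      (fun _ => Complex.Gamma θ) atTop :=
    h2.tendstoUniformly_const.tendstoLocallyUniformly
  have h4 := h1.mul₀ h3 hcontΓ continuous_const
  simp only [hΨ]
  refine h4.congr fun n s => ?_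
  rw [charFun_totalCycles hξ]
  simp only [Pi.mul_apply, hΦ]
  set w := Complex.exp (Complex.I * s)
  -- In `Φ n w / Φ n 1` the powers of `ρ` cancel and the exponentials combine to the mod-Poisson
  -- factor.
  rw [show ((K + θ * Real.log n : ℝ) : ℂ) * (1 - w) =
    (1 - θ * w) * (Real.log n : ℂ) + -(w * K) - (1 - θ * 1) * (Real.log n : ℂ) - -(1 * K) by
      push_cast; ring,
    Complex.exp_sub, Complex.exp_sub, Complex.exp_add]
  have hρn := pow_ne_zero n hρ
  have e1 := Complex.exp_ne_zero ((1 - θ * 1) * (Real.log n : ℂ))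
  have e2 := Complex.exp_ne_zero (-(1 * (K : ℂ)))
  field_simp

theorem StrongModPoisson.add_const {Ω : ℕ → Type} [∀ n, MeasurableSpace (Ω n)]
    {μ : ∀ n, Measure (Ω n)} {Z : ∀ n, Ω n → ℝ} {lam : ℕ → ℝ} {Ψ : ℝ → ℂ} {K : ℝ}
    (h : StrongModPoisson μ Z (fun n => K + lam n) Ψ) :
    StrongModPoisson μ Z lam
      (fun s => Complex.exp ((K : ℂ) * (Complex.exp (Complex.I * s) - 1)) * Ψ s) := by
  obtain ⟨hP, hZ, hcont, h0, hlim⟩ := h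
  have hc : Continuous fun s : ℝ =>
      Complex.exp ((K : ℂ) * (Complex.exp (Complex.I * s) - 1)) := by fun_prop
  refine ⟨hP, hZ, hc.mul hcont, by simp [h0], ?_⟩
  have h1 : TendstoLocallyUniformly (fun (_ : ℕ) (s : ℝ) =>
      Complex.exp ((K : ℂ) * (Complex.exp (Complex.I * s) - 1)))
      (fun s => Complex.exp ((K : ℂ) * (Complex.exp (Complex.I * s) - 1))) atTop := by
    intro u hu s
    exact ⟨Set.univ, univ_mem, Eventually.of_forall fun n y _ => refl_mem_uniformity hu⟩
  refine (h1.mul₀ hlim hc hcont).congr fun n s => ?_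
  simp only [Pi.mul_apply]
  rw [← mul_assoc, ← Complex.exp_add]
  congr 2
  push_cast
  ring

end SpatialPerm

end

/-! ### The main theorem -/

theorem mainTheorem12 {d : ℕ} (Λ : Submodule ℤ (EuclideanSpace ℝ (Fin d)))
    [DiscreteTopology Λ] [IsZLattice ℝ Λ]
    (ξ : EuclideanSpace ℝ (Fin d) → ℝ) (hξ : SpatialPerm.IsAdmissible ξ Λ)
    (a : ℕ → ℝ) (r α : ℝ) (hα : 0 < α)
    (hg : SpatialPerm.IsClassF (SpatialPerm.gAlpha a) r α) :
    ∃ K : ℝ,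
      SpatialPerm.IsClassFWith (SpatialPerm.gAlphaXi a ξ Λ) (SpatialPerm.rTilde ξ Λ * r)
        ((SpatialPerm.minCount ξ Λ : ℝ) * α) (K : ℂ) ∧
      SpatialPerm.StrongModPoisson (fun n => SpatialPerm.spatialMeasure a ξ Λ n)
        (fun n σ => (SpatialPerm.totalCycles n σ : ℝ))
        (fun n => K + (SpatialPerm.minCount ξ Λ : ℝ) * α * Real.log n)
        (fun s => Complex.Gamma (α : ℂ) /
          Complex.Gamma ((α : ℂ) * Complex.exp (Complex.I * s))) ∧
      SpatialPerm.StrongModPoisson (fun n => SpatialPerm.spatialMeasure a ξ Λ n)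
        (fun n σ => (SpatialPerm.totalCycles n σ : ℝ))
        (fun n => (SpatialPerm.minCount ξ Λ : ℝ) * α * Real.log n)
        (fun s => Complex.exp ((K : ℂ) * (Complex.exp (Complex.I * s) - 1)) *
          (Complex.Gamma (α : ℂ) /
            Complex.Gamma ((α : ℂ) * Complex.exp (Complex.I * s)))) := by
  obtain ⟨K, hK⟩ := SpatialPerm.exists_isClassFWith_gAlphaXi hξ hg
  have h1 : ((SpatialPerm.minCount ξ Λ : ℕ) : ℝ) = 1 := by
    rw [SpatialPerm.minCount_eq_one hξ, Nat.cast_one]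
  rw [h1, one_mul, SpatialPerm.rTilde_eq hξ]
  have hmod := SpatialPerm.strongModPoisson_totalCycles hξ a hα hK
  exact ⟨K, hK, hmod, hmod.add_const⟩
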